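/- Let $n,m\in\mathbb{N}$, and let $f:\mathbb{R}^n\times\mathbb{R}^m\to\mathbb{R}^n$ be continuous and Lipschitz in its first argument on bounded sets: for every $C>0$ there is $L>0$ such that $|f(y,v)-f(x,v)|\le L|y-x|$ whenever $|x|,|y|,|v|\le C$ (Euclidean norms). Let $\mathcal U=L^\infty(\mathbb{R}_+,\mathbb{R}^m)$ with the essential supremum norm $\|\cdot\|_\infty$ (of the Euclidean norm). For $x\in\mathbb{R}^n$ and $u\in\mathcal U$, let $\phi(\cdot,x,u)$ be the unique maximal Carathéodory solution of $\dot y=f(y,u)$, $y(0)=x$ (absolutely continuous on compact intervals, with the equation holding almost everywhere), defined on $[0,t_m(x,u))$ with $t_m(x,u)\in(0,\infty]$. Let $\mathcal K$ be the set of continuous, strictly increasing $\gamma:\mathbb{R}_+\to\mathbb{R}_+$ with $\gamma(0)=0$; let $\mathcal K_\infty$ be the set of unbounded functions in $\mathcal K$; let $\mathcal L$ be the set of continuous, strictly decreasing functions $\mathbb{R}_+\to\mathbb{R}_+$ that tend to $0$ at infinity; and let $\mathcal{KL}$ be the set of continuous $\beta:\mathbb{R}_+\times\mathbb{R}_+\to\mathbb{R}_+$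 with $\beta(\cdot,t)\in\mathcal K$ for all $t\ge0$ and $\beta(r,\cdot)\in\mathcal L$ for all $r>0$. The system $\dot x=f(x,u)$ is called - forward complete (FC) if $t_m(x,u)=\infty$ for all $x\in\mathbb{R}^n$, $u\in\mathcal U$; - input-to-state stable (ISS) if it is forward complete and there are $\beta\in\mathcal{KL}$, $\gamma\in\mathcal K$ with $|\phi(t,x,u)|\le\beta(|x|,t)+\gamma(\|u\|_\infty)$ for all $x\in\mathbb{R}^n$, $u\in\mathcal U$, $t\ge0$; - LIM (it has the limit property) if there is $\gamma\in\mathcal K$ with $\inf_{t}|\phi(t,x,u)|\le\gamma(\|u\|_\infty)$ for all $x\in\mathbb{R}^n$, $u\in\mathcal U$, the infimum being over all $t\in[0,t_m(x,u))$; - uniformly locally stable (ULS) if there are $\sigma,\gamma\in\mathcal K_\infty$ and $r>0$ with $|\phi(t,x,u)|\le\sigma(|x|)+\gamma(\|u\|_\infty)$ whenever $|x|\le r$, $\|u\|_\infty\le r$ and $t\in[0,t_m(x,u))$. **Theorem (ISS superposition theorem).** The system $\dot x=f(x,u)$ is ISS if and only if it is FC, LIM and ULS. -/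

import Mathlib

open MeasureTheory Filter Topology
open scoped NNReal ENNReal

/-- Class `𝒦`: continuous, strictly increasing `γ : ℝ₊ → ℝ₊` with `γ 0 = 0`. -/
structure IsClassK (γ : ℝ≥0 → ℝ≥0) : Prop where
  continuous : Continuous γ
  strictMono : StrictMono γ
  map_zero : γ 0 = 0

/-- Class `𝒦_∞`: unbounded class `𝒦` functions. -/
structure IsClassKInfty (γ : ℝ≥0 → ℝ≥0) : Prop extends IsClassK γ where
  unbounded : ¬ BddAbove (Set.range γ)

/-- Class `ℒ`: continuous, strictly decreasing functions tending to `0` at infinity. -/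
structure IsClassL (γ : ℝ≥0 → ℝ≥0) : Prop where
  continuous : Continuous γ
  strictAnti : StrictAnti γ
  tendsto_zero : Tendsto γ atTop (𝓝 0)

/-- Class `𝒦ℒ`: jointly continuous `β` with `β(·, t) ∈ 𝒦` for all `t ≥ 0` and
`β(r, ·) ∈ ℒ` for all `r > 0`. -/
structure IsClassKL (β : ℝ≥0 → ℝ≥0 → ℝ≥0) : Prop where
  continuous : Continuous (Function.uncurry β)
  classK : ∀ t, IsClassK fun r => β r t
  classL : ∀ r, 0 < r → IsClassL (β r)

/-- The input space `L^∞(ℝ₊, ℝᵐ)` with the essential supremum norm (of the Euclidean norm). -/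
noncomputable abbrev InputSpace (m : ℕ) :=
  Lp (EuclideanSpace ℝ (Fin m)) ∞ (volume.restrict (Set.Ici (0 : ℝ)))

namespace ControlSystem

variable {n m : ℕ}

/-- `y` restricted to `[0, T)`, where `0 < T ≤ ∞`, is a Caratheodory solution of
`ẏ = f(y, u)`, `y(0) = x`: it is absolutely continuous on every compact `[0, s] ⊆ [0, T)`, and
satisfies the differential equation at almost every time. -/
structure IsSolution
    (f : EuclideanSpace ℝ (Fin n) → EuclideanSpace ℝ (Fin m) → EuclideanSpace ℝ (Fin n))
    (x : EuclideanSpace ℝ (Fin n)) (u : InputSpace m) (T : ℝ≥0∞)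
    (y : ℝ → EuclideanSpace ℝ (Fin n)) : Prop where
  pos : 0 < T
  initial : y 0 = x
  absolutelyContinuous :
    ∀ s : ℝ≥0, (s : ℝ≥0∞) < T → AbsolutelyContinuousOnInterval y 0 (s : ℝ)
  deriv : ∀ᵐ t : ℝ, 0 < t → ENNReal.ofReal t < T → HasDerivAt y (f (y t) (u t)) t

/-- The maximal existence time `t_m(x, u) ∈ (0, ∞]`. -/
noncomputable def maxTime
    (f : EuclideanSpace ℝ (Fin n) → EuclideanSpace ℝ (Fin m) → EuclideanSpace ℝ (Fin n))
    (x : EuclideanSpace ℝ (Fin n)) (u : InputSpace m) : ℝ≥0∞ :=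
  sSup {T | ∃ y, IsSolution f x u T y}

open Classical in
/-- The flow `φ(t, x, u)`: the value at time `t` of the maximal solution, which lives on
`[0, t_m(x, u))`. (Under the standing assumptions on `f` that solution exists and is unique;
only times `t < t_m(x, u)` are meaningful.) -/
noncomputable def flow
    (f : EuclideanSpace ℝ (Fin n) → EuclideanSpace ℝ (Fin m) → EuclideanSpace ℝ (Fin n))
    (x : EuclideanSpace ℝ (Fin n)) (u : InputSpace m) (t : ℝ≥0) : EuclideanSpace ℝ (Fin n) :=
  if h : ∃ y, IsSolution f x u (maxTime f x u) y then h.choose (t : ℝ) else 0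

/-- Forward completeness (FC). -/
def ForwardComplete
    (f : EuclideanSpace ℝ (Fin n) → EuclideanSpace ℝ (Fin m) → EuclideanSpace ℝ (Fin n)) : Prop :=
  ∀ x u, maxTime f x u = ∞

/-- Input-to-state stability (ISS). -/
def ISS
    (f : EuclideanSpace ℝ (Fin n) → EuclideanSpace ℝ (Fin m) → EuclideanSpace ℝ (Fin n)) : Prop :=
  ForwardComplete f ∧
    ∃ (β : ℝ≥0 → ℝ≥0 → ℝ≥0) (γ : ℝ≥0 → ℝ≥0), IsClassKL β ∧ IsClassK γ ∧
      ∀ (x : EuclideanSpace ℝ (Fin n)) (u : InputSpace m) (t : ℝ≥0),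
        ‖flow f x u t‖₊ ≤ β ‖x‖₊ t + γ ‖u‖₊

/-- Limit property (LIM). The infimum runs over the times at which the solution exists, that is,
over all `t ≥ 0` if the system is forward complete. -/
def LimitProperty
    (f : EuclideanSpace ℝ (Fin n) → EuclideanSpace ℝ (Fin m) → EuclideanSpace ℝ (Fin n)) : Prop :=
  ∃ γ : ℝ≥0 → ℝ≥0, IsClassK γ ∧
    ∀ (x : EuclideanSpace ℝ (Fin n)) (u : InputSpace m),
      ⨅ t : {t : ℝ≥0 // (t : ℝ≥0∞) < maxTime f x u}, ‖flow f x u t‖₊ ≤ γ ‖u‖₊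

/-- Uniform local stability (ULS). The estimate is required at all times at which the solution
exists, that is, at all `t ≥ 0` if the system is forward complete. -/
def UniformlyLocallyStable
    (f : EuclideanSpace ℝ (Fin n) → EuclideanSpace ℝ (Fin m) → EuclideanSpace ℝ (Fin n)) : Prop :=
  ∃ (σ γ : ℝ≥0 → ℝ≥0) (r : ℝ≥0), IsClassKInfty σ ∧ IsClassKInfty γ ∧ 0 < r ∧
    ∀ (x : EuclideanSpace ℝ (Fin n)) (u : InputSpace m) (t : ℝ≥0),
      ‖x‖₊ ≤ r → ‖u‖₊ ≤ r → (t : ℝ≥0∞) < maxTime f x u →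
        ‖flow f x u t‖₊ ≤ σ ‖x‖₊ + γ ‖u‖₊

end ControlSystem

/-! ISS gives LIM and ULS at once: let `t → ∞` in the estimate, or replace `β(r, t)` by `β(r, 0)`.
The converse needs uniformity: LIM alone gives no bound on how long, or how far out, a trajectory
may wander before it comes near the ball of radius `γ(‖u‖)`.

That uniformity is `exists_uniform_bound_outside`, a compactness argument. If it fails, there are
trajectories from a fixed ball that stay outside the ball of radius `r` while elapsed time plus
final norm is arbitrarily large. Their inputs need not converge in any useful sense, since `f` is
nonlinear in the input. The states do converge, along an ultrafilter, at suitable grid times. On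
each grid interval one trajectory of the sequence nearly joins the two limit points; the inputs of
these pieces are concatenated. The pieces do not fit together exactly, but solving backward in time
and taking an inverse limit of compact balls (`exists_shadowing`) yields a true solution close to
all of them. By forward completeness the grid times are unbounded, so this solution avoids the
smaller ball of radius `r'` forever, contradicting LIM.

Uniform boundedness (`HasLimitGain.exists_bound`) and a uniform reaching time
(`HasLimitGain.exists_uniform_time`) follow. With ULS the bound becomes a `𝒦_∞` function of the
data; restarting when a trajectory reaches the `γ`-ball gives uniform attraction, and
comparison-function lemmas turn the two into a `𝒦ℒ` estimate. -/

open Set Metric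

/-! ### Integral equations: short-time estimates, backward solvability, inverse limits -/

section IntegralEquation

set_option linter.unusedSectionVars false

variable {E F : Type*} [NormedAddCommGroup E] [NormedSpace ℝ E] [ProperSpace E]
  [NormedAddCommGroup F] [ProperSpace F] [MeasurableSpace F] [BorelSpace F]
  {f : E → F → E} {R B h a b : ℝ} {v : ℝ → F} {y z : ℝ → E}

/-- A continuous right-hand side that is Lipschitz in the state on bounded sets. -/
structure IsRegularField (f : E → F → E) : Prop where
  continuous : Continuous (Function.uncurry f)
  lipschitz : ∀ C : ℝ, 0 < C → ∃ L : ℝ, 0 < L ∧ ∀ (x y : E) (v : F),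
    ‖x‖ ≤ C → ‖y‖ ≤ C → ‖v‖ ≤ C → ‖f y v - f x v‖ ≤ L * ‖y - x‖

/-- A measurable input with values in the closed ball of radius `R`. -/
structure IsInput (R : ℝ) (v : ℝ → F) : Prop where
  measurable : Measurable v
  norm_le : ∀ t, ‖v t‖ ≤ R

/-- `y` solves the integral equation of `ẏ = f(y, v)` on `[a, b]`. -/
structure IsSolOn (f : E → F → E) (v : ℝ → F) (a b : ℝ) (y : ℝ → E) : Prop where
  continuousOn : ContinuousOn y (Icc a b)
  sub_eq : ∀ s ∈ Icc a b, ∀ t ∈ Icc a b, y t - y s = ∫ τ in s..t, f (y τ) (v τ)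

/-- `y` solves the integral equation of `ẏ = f(y, v)` on `[0, ∞)`. -/
structure IsTraj (f : E → F → E) (v : ℝ → F) (y : ℝ → E) : Prop where
  continuous : Continuous y
  sub_eq : ∀ s t, 0 ≤ s → 0 ≤ t → y t - y s = ∫ τ in s..t, f (y τ) (v τ)

/-- On the ball of radius `B` and for inputs bounded by `R`, solutions move by at most `1/2` within
time `h`, and the Picard operator over time `h` is a `1/2`-contraction. -/
structure IsStep (f : E → F → E) (R B h : ℝ) : Prop where
  pos : 0 < h
  norm_le : ∀ x v, ‖x‖ ≤ B → ‖v‖ ≤ R → h * ‖f x v‖ ≤ 1 / 2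
  lip : ∀ x y v, ‖x‖ ≤ B → ‖y‖ ≤ B → ‖v‖ ≤ R → h * ‖f y v - f x v‖ ≤ 1 / 2 * ‖y - x‖

lemma IsInput.mono {R' : ℝ} (hv : IsInput R v) (hR : R ≤ R') : IsInput R' v :=
  ⟨hv.measurable, fun t => (hv.norm_le t).trans hR⟩

lemma IsInput.shift (hv : IsInput R v) (s : ℝ) : IsInput R (fun t => v (s + t)) :=
  ⟨hv.measurable.comp (measurable_const_add s), fun _ => hv.norm_le _⟩

lemma IsTraj.shift (hy : IsTraj f v y) {s : ℝ} (hs : 0 ≤ s) :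
    IsTraj f (fun t => v (s + t)) (fun t => y (s + t)) where
  continuous := hy.continuous.comp (continuous_const.add continuous_id)
  sub_eq p q hp hq := by
    rw [hy.sub_eq (s + p) (s + q) (by positivity) (by positivity),
      intervalIntegral.integral_comp_add_left (fun τ => f (y τ) (v τ)) s]

lemma IsTraj.isSolOn (hy : IsTraj f v y) (ha : 0 ≤ a) : IsSolOn f v a b y where
  continuousOn := hy.continuous.continuousOn
  sub_eq s hs t ht := hy.sub_eq s t (ha.trans hs.1) (ha.trans ht.1)

lemma IsSolOn.mono {a' b' : ℝ} (hy : IsSolOn f v a b y) (h : Icc a' b' ⊆ Icc a b) :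
    IsSolOn f v a' b' y :=
  ⟨hy.continuousOn.mono h, fun s hs t ht => hy.sub_eq s (h hs) t (h ht)⟩

lemma IsSolOn.congr_input {w : ℝ → F} (hy : IsSolOn f v a b y)
    (h : ∀ t ∈ Ico a b, v t = w t) : IsSolOn f w a b y where
  continuousOn := hy.continuousOn
  sub_eq s hs t ht := by
    rw [hy.sub_eq s hs t ht]
    refine intervalIntegral.integral_congr_ae ?_
    have : ∀ᵐ τ : ℝ, τ ≠ b := by simp [ae_iff]
    filter_upwards [this] with τ hτ hmem
    have hm := uIoc_subset_uIcc hmem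
    have h1 := (uIcc_subset_Icc hs ht) hm
    rw [h τ ⟨h1.1, lt_of_le_of_ne h1.2 hτ⟩]

lemma IsRegularField.exists_norm_le (hf : IsRegularField f) (R B : ℝ) :
    ∃ M, 0 < M ∧ ∀ x v, ‖x‖ ≤ B → ‖v‖ ≤ R → ‖f x v‖ ≤ M := by
  obtain ⟨M, hM⟩ := ((isCompact_closedBall (0 : E) B).prod
    (isCompact_closedBall (0 : F) R)).exists_bound_of_continuousOn hf.continuous.continuousOn
  refine ⟨max M 1, by positivity, fun x v hx hv => (hM (x, v) ?_).trans (le_max_left _ _)⟩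
  simp [hx, hv]

/-- With `M` bounding `f` and `L` its Lipschitz constant on the relevant balls, `h = min (1/(2M))
(1/(2L))` works. -/
lemma IsRegularField.exists_isStep (hf : IsRegularField f) (R B : ℝ) : ∃ h, IsStep f R B h := by
  obtain ⟨M, hM0, hM⟩ := hf.exists_norm_le R B
  obtain ⟨L, hL0, hL⟩ := hf.lipschitz (max 1 (max R B)) (by positivity)
  have h1 : 0 < min (1 / (2 * M)) (1 / (2 * L)) := by positivity
  refine ⟨_, h1, fun x v hx hv => ?_, fun x y v hx hy hv => ?_⟩
  · calc _ ≤ 1 / (2 * M) * M := mul_le_mul (min_le_left _ _)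
          (hM x v hx hv) (norm_nonneg _) (by positivity)
      _ = 1 / 2 := by field_simp
  · have hB : B ≤ max 1 (max R B) := (le_max_right _ _).trans (le_max_right _ _)
    have hR : R ≤ max 1 (max R B) := (le_max_left _ _).trans (le_max_right _ _)
    calc _ ≤ 1 / (2 * L) * (L * ‖y - x‖) := mul_le_mul (min_le_right _ _)
          (hL x y v (hx.trans hB) (hy.trans hB) (hv.trans hR)) (norm_nonneg _) (by positivity)
      _ = 1 / 2 * ‖y - x‖ := by field_simp

lemma IsRegularField.integrableOn (hf : IsRegularField f) (hv : IsInput R v)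
    (hy : ContinuousOn y (Icc a b)) : IntegrableOn (fun τ => f (y τ) (v τ)) (Icc a b) := by
  obtain ⟨C, hC⟩ := isCompact_Icc.exists_bound_of_continuousOn hy
  obtain ⟨M, -, hM⟩ := hf.exists_norm_le R C
  refine Integrable.of_bound ?_ M ?_
  · exact hf.continuous.comp_aestronglyMeasurable
      ((hy.aestronglyMeasurable measurableSet_Icc).prodMk
        hv.measurable.stronglyMeasurable.aestronglyMeasurable)
  · exact (ae_restrict_mem measurableSet_Icc).mono fun τ hτ => hM _ _ (hC τ hτ) (hv.norm_le τ)

lemma IsRegularField.intervalIntegrable (hf : IsRegularField f) (hv : IsInput R v)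
    (hy : ContinuousOn y (Icc a b)) {s t : ℝ} (hs : s ∈ Icc a b) (ht : t ∈ Icc a b) :
    IntervalIntegrable (fun τ => f (y τ) (v τ)) volume s t :=
  ((hf.integrableOn hv hy).mono_set
    (uIcc_subset_Icc hs ht)).intervalIntegrable

lemma norm_integral_le_of_step {g : ℝ → E} {s t h C : ℝ} (hh : 0 < h) (hC : 0 ≤ C)
    (hst : |t - s| ≤ h) (hg : ∀ τ ∈ uIoc s t, h * ‖g τ‖ ≤ C) : ‖∫ τ in s..t, g τ‖ ≤ C := by
  have := intervalIntegral.norm_integral_le_of_norm_le_const (C := C / h) (f := g) (a := s) (b := t)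
    fun τ hτ => by rw [le_div_iff₀ hh, mul_comm]; exact hg τ hτ
  refine this.trans ?_
  calc C / h * |t - s| ≤ C / h * h := by gcongr
    _ = C := by field_simp

lemma abs_sub_le_of_mem_Icc {s t : ℝ} (hs : s ∈ Icc a b) (ht : t ∈ Icc a b) (hab : b - a ≤ h) :
    |t - s| ≤ h := by
  rw [abs_le]; constructor <;> linarith [hs.1, hs.2, ht.1, ht.2]

/-- A continuity argument: as long as the displacement is at most `1` the solution stays in the ball
of radius `B`, where the speed bound limits the displacement to `1/2`; so it can never reach `1`. -/
lemma IsSolOn.norm_sub_left_le (hy : IsSolOn f v a b y) (hv : IsInput R v) (hs : IsStep f R B h)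
    (hab : b - a ≤ h) (hB : ‖y a‖ + 1 ≤ B) {t : ℝ} (ht : t ∈ Icc a b) :
    ‖y t - y a‖ ≤ 1 / 2 := by
  have hle : a ≤ b := ht.1.trans ht.2
  have key : ∀ t ∈ Icc a b, (∀ s ∈ Ico a t, ‖y s - y a‖ ≤ 1) → ‖y t - y a‖ ≤ 1 / 2 := by
    intro t ht hlt
    rw [hy.sub_eq a (left_mem_Icc.2 hle) t ht, intervalIntegral.integral_of_le ht.1,
      integral_Ioc_eq_integral_Ioo]
    have := norm_setIntegral_le_of_norm_le_const (μ := volume) (s := Ioo a t) (C := 1 / 2 / h)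
      (f := fun τ => f (y τ) (v τ)) (by simp) fun τ hτ => by
        rw [le_div_iff₀ hs.pos, mul_comm]
        refine hs.norm_le _ _ ?_ (hv.norm_le τ)
        have h1 := hlt τ ⟨hτ.1.le, hτ.2⟩
        have h2 := norm_sub_norm_le (y τ) (y a)
        linarith
    refine this.trans ?_
    have h3 : volume.real (Ioo a t) = t - a := by simp [ht.1]
    rw [h3]
    calc 1 / 2 / h * (t - a) ≤ 1 / 2 / h * h := by
          have := hs.pos
          gcongr; linarith [ht.2]
      _ = 1 / 2 := by have := hs.pos; field_simp
  refine key t ht ?_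
  by_contra! hcon
  obtain ⟨s, hst, hs1⟩ := hcon
  have hcont : ContinuousOn (fun τ => ‖y τ - y a‖) (Icc a b) :=
    (hy.continuousOn.sub continuousOn_const).norm
  have hcl : IsClosed (Icc a b ∩ (fun τ => ‖y τ - y a‖) ⁻¹' Ici 1) :=
    hcont.preimage_isClosed_of_isClosed isClosed_Icc isClosed_Ici
  have hcpt := isCompact_Icc.of_isClosed_subset hcl inter_subset_left
  obtain ⟨m, hm, hmin⟩ := hcpt.exists_isLeast ⟨s, ⟨hst.1, hst.2.le.trans ht.2⟩, hs1.le⟩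
  have := key m hm.1 fun s' hs' => by
    by_contra! hc
    exact absurd (hmin ⟨⟨hs'.1, hs'.2.le.trans hm.1.2⟩, hc.le⟩) (not_le.2 hs'.2)
  have h1 : (1 : ℝ) ≤ ‖y m - y a‖ := hm.2
  linarith

/-- At the time where the distance is largest, it exceeds the distance at `c` by at most half of
itself. The reference time `c` may lie on either side of `t`, so the factor `2` also controls
backward propagation. -/
lemma IsSolOn.norm_sub_le (hf : IsRegularField f) (hy : IsSolOn f v a b y) (hz : IsSolOn f v a b z)
    (hv : IsInput R v) (hs : IsStep f R B h) (hab : b - a ≤ h)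
    (hyB : ∀ t ∈ Icc a b, ‖y t‖ ≤ B) (hzB : ∀ t ∈ Icc a b, ‖z t‖ ≤ B)
    {c t : ℝ} (hc : c ∈ Icc a b) (ht : t ∈ Icc a b) : ‖y t - z t‖ ≤ 2 * ‖y c - z c‖ := by
  obtain ⟨m, hm, hmax⟩ := isCompact_Icc.exists_isMaxOn ⟨c, hc⟩
    ((hy.continuousOn.sub hz.continuousOn).norm)
  have hmax' : ∀ τ ∈ Icc a b, ‖y τ - z τ‖ ≤ ‖y m - z m‖ := fun τ hτ => hmax hτ
  have h1 : (y m - z m) - (y c - z c) = ∫ τ in c..m, (f (y τ) (v τ) - f (z τ) (v τ)) := by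
    rw [intervalIntegral.integral_sub (hf.intervalIntegrable hv hy.continuousOn hc hm)
      (hf.intervalIntegrable hv hz.continuousOn hc hm), ← hy.sub_eq c hc m hm,
      ← hz.sub_eq c hc m hm]
    abel
  have h2 : ‖(y m - z m) - (y c - z c)‖ ≤ 1 / 2 * ‖y m - z m‖ := by
    rw [h1]
    refine norm_integral_le_of_step hs.pos (by positivity) (abs_sub_le_of_mem_Icc hc hm hab) ?_
    intro τ hτ
    have hτ' := uIcc_subset_Icc hc hm (uIoc_subset_uIcc hτ)
    refine (hs.lip _ _ _ (hzB τ hτ') (hyB τ hτ') (hv.norm_le τ)).trans ?_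
    gcongr
    exact hmax' τ hτ'
  have h3 := norm_sub_norm_le (y m - z m) (y c - z c)
  linarith [hmax' t ht]

/-- Solutions with prescribed terminal value over one step. -/
lemma IsStep.exists_isSolOn (hf : IsRegularField f) (hs : IsStep f R B h) (hv : IsInput R v)
    (hle : a ≤ b) (hab : b - a ≤ h) {x : E} (hx : ‖x‖ + 1 ≤ B) :
    ∃ y, IsSolOn f v a b y ∧ y b = x ∧ ∀ t ∈ Icc a b, ‖y t - x‖ ≤ 1 / 2 := by
  let g : C(Icc a b, E) → ℝ → E := fun c τ => f (c (projIcc a b hle τ)) (v τ)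
  have hext (c : C(Icc a b, E)) : Continuous fun τ => c (projIcc a b hle τ) :=
    c.continuous.comp continuous_projIcc
  have hint (c : C(Icc a b, E)) (s t : ℝ) : IntervalIntegrable (g c) volume s t :=
    hf.intervalIntegrable (a := min s t) (b := max s t) hv (hext c).continuousOn
      ⟨min_le_left _ _, le_max_left _ _⟩ ⟨min_le_right _ _, le_max_right _ _⟩
  -- The Picard operator based at the right end point `b`, so that its fixed point has the
  -- prescribed terminal value.
  let T : C(Icc a b, E) → C(Icc a b, E) := fun c =>
    ⟨fun t => x + ∫ τ in b..t, g c τ, (continuous_const.add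
      (intervalIntegral.continuous_primitive (hint c) b)).comp continuous_subtype_val⟩
  let S : Set C(Icc a b, E) := closedBall (ContinuousMap.const _ x) (1 / 2)
  have hSn : ∀ c ∈ S, ∀ t, ‖c t‖ ≤ B := fun c hc t => by
    have h1 := (ContinuousMap.dist_apply_le_dist (f := c) (g := ContinuousMap.const _ x) t).trans hc
    rw [dist_eq_norm] at h1
    have h2 := norm_sub_norm_le (c t) x
    have h3 : ‖c t - x‖ ≤ 1 / 2 := h1
    linarith
  have hmem : ∀ t : Icc a b, |(t : ℝ) - b| ≤ h := fun t =>
    abs_sub_le_of_mem_Icc (right_mem_Icc.2 hle) t.2 hab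
  have hmaps : MapsTo T S S := fun c hc => by
    refine (ContinuousMap.dist_le (by norm_num)).2 fun t => ?_
    rw [dist_eq_norm]
    have : T c t - ContinuousMap.const _ x t = ∫ τ in b..t, g c τ := by
      change (x + ∫ τ in b..t, g c τ) - x = _
      abel
    rw [this]
    exact norm_integral_le_of_step hs.pos (by norm_num) (hmem t) fun τ _ =>
      hs.norm_le _ _ (hSn c hc _) (hv.norm_le τ)
  have hcontr : ContractingWith (1 / 2 : ℝ≥0) (hmaps.restrict T S S) := by
    refine ⟨by rw [← NNReal.coe_lt_coe]; norm_num, LipschitzWith.of_dist_le_mul fun c d => ?_⟩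
    refine (ContinuousMap.dist_le (by positivity)).2 fun t => ?_
    rw [dist_eq_norm]
    have : T c t - T d t = ∫ τ in b..t, (g c τ - g d τ) := by
      rw [intervalIntegral.integral_sub (hint c _ _) (hint d _ _)]
      change (x + ∫ τ in b..t, g c τ) - (x + ∫ τ in b..t, g d τ) = _
      abel
    change ‖T c t - T d t‖ ≤ _
    rw [this]
    refine norm_integral_le_of_step hs.pos (by positivity) (hmem t) fun τ _ => ?_
    refine (hs.lip _ _ _ (hSn d.1 d.2 _) (hSn c.1 c.2 _) (hv.norm_le τ)).trans ?_
    have h1 := ContinuousMap.dist_apply_le_dist (f := c.1) (g := d.1) (projIcc a b hle τ)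
    rw [dist_eq_norm] at h1
    have h2 : ‖c.1 (projIcc a b hle τ) - d.1 (projIcc a b hle τ)‖ ≤ dist c d := h1
    simpa using h2
  have hx0 : ContinuousMap.const _ x ∈ S := mem_closedBall_self (by norm_num)
  obtain ⟨c, hcS, hfix, -⟩ := hcontr.exists_fixedPoint' isClosed_closedBall.isComplete hmaps hx0
    (edist_ne_top _ _)
  have hval : ∀ t : Icc a b, c t = x + ∫ τ in b..t, g c τ := fun t =>
    (congrArg (fun d : C(Icc a b, E) => d t) hfix).symm
  have hproj : ∀ t (ht : t ∈ Icc a b), c (projIcc a b hle t) = x + ∫ τ in b..t, g c τ :=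
    fun t ht => by rw [projIcc_of_mem hle ht, hval]
  refine ⟨fun t => c (projIcc a b hle t), ⟨(hext c).continuousOn, fun s hs t ht => ?_⟩, ?_,
    fun t _ => ?_⟩
  · rw [hproj t ht, hproj s hs, ← intervalIntegral.integral_interval_sub_left (hint c b t)
      (hint c b s)]
    abel
  · change c (projIcc a b hle b) = x
    rw [hproj b (right_mem_Icc.2 hle), intervalIntegral.integral_same, add_zero]
  · have h1 := (ContinuousMap.dist_apply_le_dist (f := c) (g := ContinuousMap.const _ x)
      (projIcc a b hle t)).trans hcS
    rwa [dist_eq_norm] at h1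

/-- Inverse limits of sequences of nonempty compact sets are nonempty. -/
lemma exists_backward_orbit {X : Type*} [TopologicalSpace X] [T2Space X] {K : ℕ → Set X}
    (hK : ∀ i, IsCompact (K i)) (hne : ∀ i, (K i).Nonempty) (Ψ : ℕ → X → X)
    (hΨ : ∀ i, ContinuousOn (Ψ i) (K (i + 1))) (hmaps : ∀ i, MapsTo (Ψ i) (K (i + 1)) (K i)) :
    ∃ q : ℕ → X, ∀ i, q i ∈ K i ∧ Ψ i (q (i + 1)) = q i := by
  choose c hc using hne
  -- `G d i` is the point `c (i + d)` pulled back `d` times to level `i`. Along `d = j - i` the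
  -- compatibility with `Ψ` is exact once `j > i`, and continuity carries it to the limit in `j`.
  let G : ℕ → ℕ → X := Nat.rec c fun _ g i => Ψ i (g (i + 1))
  have hG : ∀ d i, G d i ∈ K i := by
    intro d
    induction d with
    | zero => exact hc
    | succ d ih => exact fun i => hmaps i (ih (i + 1))
  have hlim : ∀ i, ∃ x ∈ K i, Tendsto (fun j => G (j - i) i) (hyperfilter ℕ) (𝓝 x) := fun i =>
    (hK i).ultrafilter_le_nhds ((hyperfilter ℕ).map fun j => G (j - i) i)
      (tendsto_principal.2 (Eventually.of_forall fun j => hG (j - i) i))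
  choose q hqK hq using hlim
  refine ⟨q, fun i => ⟨hqK i, tendsto_nhds_unique ?_ (hq i)⟩⟩
  have h1 : Tendsto (fun j => G (j - (i + 1)) (i + 1)) (hyperfilter ℕ) (𝓝[K (i + 1)] q (i + 1)) :=
    tendsto_nhdsWithin_iff.2 ⟨hq (i + 1), Eventually.of_forall fun j => hG _ _⟩
  refine ((hΨ i _ (hqK (i + 1))).tendsto.comp h1).congr' ?_
  have h2 : ∀ᶠ j in (hyperfilter ℕ : Filter ℕ), i < j :=
    Nat.hyperfilter_le_atTop (eventually_gt_atTop i)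
  filter_upwards [h2] with j hj
  have : j - i = (j - (i + 1)) + 1 := by omega
  rw [this]
  rfl

end IntegralEquation

/-! ### Shadowing and the compactness argument for uniform reaching -/

section UniformReaching

set_option linter.unusedSectionVars false

variable {E F : Type*} [NormedAddCommGroup E] [NormedSpace ℝ E] [ProperSpace E]
  [NormedAddCommGroup F] [ProperSpace F] [MeasurableSpace F] [BorelSpace F]
  {f : E → F → E} {R B h a b : ℝ} {v : ℝ → F} {y z : ℝ → E}

/-- Uniqueness of solutions of the integral equation. -/
lemma IsSolOn.eqOn (hf : IsRegularField f) (hv : IsInput R v) (hy : IsSolOn f v a b y)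
    (hz : IsSolOn f v a b z) (hyz : y a = z a) : EqOn y z (Icc a b) := by
  obtain ⟨C, hC⟩ := isCompact_Icc.exists_bound_of_continuousOn hy.continuousOn
  obtain ⟨D, hD⟩ := isCompact_Icc.exists_bound_of_continuousOn hz.continuousOn
  obtain ⟨h, hh⟩ := hf.exists_isStep R (max C D)
  -- Both solutions lie in one ball, so a single step length serves the whole interval.
  have key : ∀ j : ℕ, ∀ t ∈ Icc a b, t ≤ a + j * h → y t = z t := by
    intro j
    induction j with
    | zero =>
      intro t ht htj
      have : t = a := le_antisymm (by simpa using htj) ht.1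
      rw [this, hyz]
    | succ j ih =>
      intro t ht htj
      by_cases hc : t ≤ a + j * h
      · exact ih t ht hc
      push Not at hc
      have hj : 0 ≤ j * h := by have := hh.pos; positivity
      have hsub : Icc (a + j * h) t ⊆ Icc a b := Icc_subset_Icc (by linarith) ht.2
      have hl : a + j * h ∈ Icc a b := hsub ⟨le_rfl, hc.le⟩
      push_cast at htj
      have := (hy.mono hsub).norm_sub_le hf (hz.mono hsub) hv hh (by linarith)
        (fun s hs => (hC s (hsub hs)).trans (le_max_left _ _))
        (fun s hs => (hD s (hsub hs)).trans (le_max_right _ _)) ⟨le_rfl, hc.le⟩ ⟨hc.le, le_rfl⟩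
      rw [ih _ hl le_rfl, sub_self, norm_zero, mul_zero] at this
      exact sub_eq_zero.1 (norm_le_zero_iff.1 this)
  intro t ht
  obtain ⟨j, hj⟩ := exists_nat_ge ((t - a) / h)
  rw [div_le_iff₀ hh.pos] at hj
  exact key j t ht (by linarith)

/-- Concatenation of countably many inputs. -/
lemma exists_concat_input {v : ℕ → ℝ → F} (hv : ∀ i, IsInput R (v i)) {t : ℕ → ℝ}
    (ht : StrictMono t) :
    ∃ w : ℝ → F, IsInput R w ∧ ∀ i, ∀ s ∈ Ico (t i) (t (i + 1)), w s = v i s := by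
  classical
  -- The `t i` are not assumed unbounded. Times beyond all of them satisfy the second alternative
  -- and receive the input `v 0`.
  have hp : ∀ s : ℝ, ∃ N, s < t (N + 1) ∨ ∀ i, t (i + 1) ≤ s := fun s => by
    by_cases hs : ∃ N, s < t (N + 1)
    · exact hs.imp fun _ => Or.inl
    · push Not at hs
      exact ⟨0, Or.inr hs⟩
  have hι : Measurable fun s => Nat.find (hp s) := by
    refine measurable_find hp fun k => MeasurableSet.union measurableSet_Iio ?_
    have : {s : ℝ | ∀ i, t (i + 1) ≤ s} = ⋂ i, Ici (t (i + 1)) := by ext; simp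
    change MeasurableSet {s : ℝ | ∀ i, t (i + 1) ≤ s}
    rw [this]
    exact MeasurableSet.iInter fun _ => measurableSet_Ici
  have hm : Measurable fun q : ℕ × ℝ => v q.1 q.2 :=
    measurable_from_prod_countable_right fun i => (hv i).measurable
  refine ⟨fun s => v (Nat.find (hp s)) s, ⟨hm.comp (hι.prodMk measurable_id),
    fun s => (hv _).norm_le s⟩, fun i s hs => ?_⟩
  have : Nat.find (hp s) = i := by
    rw [Nat.find_eq_iff]
    refine ⟨Or.inl hs.2, fun j hj hc => ?_⟩
    rcases hc with hc | hc
    · have := ht.monotone (show j + 1 ≤ i by omega)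
      linarith [hs.1]
    · linarith [hc i, hs.2]
  simp only [this]

/-- Pieces of trajectories whose end points almost match are shadowed by pieces of trajectories
that match exactly. -/
lemma exists_shadowing (hf : IsRegularField f) {v : ℕ → ℝ → F} (hv : ∀ i, IsInput R (v i))
    {t H Bd : ℕ → ℝ} {p : ℕ → E} {θ : ℕ → ℝ → E} {ε : ℝ} (hε : 0 < ε) (hε1 : ε ≤ 1)
    (ht : ∀ i, t (i + 1) = t i + H i) (hH : ∀ i, IsStep f R (Bd i) (H i))
    (hp : ∀ i, ‖p i‖ + 4 ≤ Bd i) (hθ : ∀ i, IsSolOn f (v i) (t i) (t (i + 1)) (θ i))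
    (hl : ∀ i, ‖θ i (t i) - p i‖ ≤ ε / 8 ^ i / 2)
    (hr : ∀ i, ‖θ i (t (i + 1)) - p (i + 1)‖ ≤ ε / 8 ^ (i + 1)) :
    ∃ (q : ℕ → E) (Y : ℕ → ℝ → E), ∀ i, ‖q i - p i‖ ≤ ε ∧
      IsSolOn f (v i) (t i) (t (i + 1)) (Y i) ∧ Y i (t i) = q i ∧ Y i (t (i + 1)) = q (i + 1) ∧
      ∀ s ∈ Icc (t i) (t (i + 1)), ‖Y i s - θ i s‖ ≤ ε := by
  have hεi : ∀ i, ε / 8 ^ i ≤ ε := fun i => div_le_self hε.le (one_le_pow₀ (by norm_num))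
  have hεi0 : ∀ i, 0 < ε / 8 ^ i := fun i => by positivity
  have hεs : ∀ i, ε / 8 ^ (i + 1) = ε / 8 ^ i / 8 := fun i => by rw [pow_succ]; field_simp
  have hle : ∀ i, t i ≤ t (i + 1) := fun i => by rw [ht]; linarith [(hH i).pos]
  have hab : ∀ i, t (i + 1) - t i ≤ H i := fun i => by rw [ht]; linarith
  have hθ0 : ∀ i, ‖θ i (t i)‖ ≤ ‖p i‖ + 1 := fun i => by
    have := norm_sub_norm_le (θ i (t i)) (p i)
    linarith [hl i, hεi i]
  have hθB : ∀ i, ∀ s ∈ Icc (t i) (t (i + 1)), ‖θ i s‖ ≤ ‖p i‖ + 2 := fun i s hs => by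
    have h1 := (hθ i).norm_sub_left_le (hv i) (hH i) (hab i) (by linarith [hθ0 i, hp i]) hs
    have h2 := norm_sub_norm_le (θ i s) (θ i (t i))
    linarith [hθ0 i]
  -- The ratio `8` closes the error budget: the distance at the right end is at most `2ε/8^(i+1) =
  -- ε/8^i/4`, going back over the step doubles it, and `hl` adds the other `ε/8^i/2`. Backward
  -- solutions thus map each ball into the previous one.
  have hzθ : ∀ i, ∀ x ∈ closedBall (p (i + 1)) (ε / 8 ^ (i + 1)),
      ‖x - θ i (t (i + 1))‖ ≤ ε / 8 ^ i / 4 := fun i x hx => by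
    rw [mem_closedBall, dist_eq_norm] at hx
    have h1 := norm_sub_le_norm_sub_add_norm_sub x (p (i + 1)) (θ i (t (i + 1)))
    rw [norm_sub_rev (p (i + 1))] at h1
    linarith [hr i, hεs i]
  have hxB : ∀ i, ∀ x ∈ closedBall (p (i + 1)) (ε / 8 ^ (i + 1)), ‖x‖ ≤ ‖p i‖ + 3 :=
    fun i x hx => by
      have h1 := hθB i _ (right_mem_Icc.2 (hle i))
      have h2 := norm_sub_norm_le x (θ i (t (i + 1)))
      linarith [hzθ i x hx, hεi i]
  have hex : ∀ i (x : E), ∃ Y : ℝ → E, x ∈ closedBall (p (i + 1)) (ε / 8 ^ (i + 1)) →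
      IsSolOn f (v i) (t i) (t (i + 1)) Y ∧ Y (t (i + 1)) = x ∧
      ∀ s ∈ Icc (t i) (t (i + 1)), ‖Y s‖ ≤ Bd i := fun i x => by
    by_cases hx : x ∈ closedBall (p (i + 1)) (ε / 8 ^ (i + 1))
    · obtain ⟨Y, h1, h2, h3⟩ := (hH i).exists_isSolOn hf (hv i) (hle i) (hab i) (x := x)
        (by linarith [hxB i x hx, hp i])
      refine ⟨Y, fun _ => ⟨h1, h2, fun s hs => ?_⟩⟩
      have h4 := norm_sub_norm_le (Y s) x
      linarith [hxB i x hx, hp i, h3 s hs]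
    · exact ⟨0, fun h => absurd h hx⟩
  choose Y hY using hex
  have hYθ : ∀ i, ∀ x ∈ closedBall (p (i + 1)) (ε / 8 ^ (i + 1)), ∀ s ∈ Icc (t i) (t (i + 1)),
      ‖Y i x s - θ i s‖ ≤ ε / 8 ^ i / 2 := fun i x hx s hs => by
    obtain ⟨h1, h2, h3⟩ := hY i x hx
    have h4 := h1.norm_sub_le hf (hθ i) (hv i) (hH i) (hab i) h3
      (fun s hs => by linarith [hθB i s hs, hp i]) (right_mem_Icc.2 (hle i)) hs
    rw [h2] at h4
    linarith [hzθ i x hx]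
  obtain ⟨q, hq⟩ := exists_backward_orbit (K := fun i => closedBall (p i) (ε / 8 ^ i))
    (fun i => isCompact_closedBall _ _) (fun i => ⟨p i, mem_closedBall_self (hεi0 i).le⟩)
    (fun i x => Y i x (t i)) (fun i => by
      refine (LipschitzOnWith.of_dist_le_mul (K := 2) fun x hx x' hx' => ?_).continuousOn
      obtain ⟨h1, h2, h3⟩ := hY i x hx
      obtain ⟨h1', h2', h3'⟩ := hY i x' hx'
      have h4 := h1.norm_sub_le hf h1' (hv i) (hH i) (hab i) h3 h3'
        (right_mem_Icc.2 (hle i)) (left_mem_Icc.2 (hle i))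
      rw [h2, h2'] at h4
      simpa [dist_eq_norm] using h4)
    (fun i x hx => by
      have h1 := hYθ i x hx _ (left_mem_Icc.2 (hle i))
      have h2 := norm_sub_le_norm_sub_add_norm_sub (Y i x (t i)) (θ i (t i)) (p i)
      rw [mem_closedBall, dist_eq_norm]
      linarith [hl i])
  refine ⟨q, fun i => Y i (q (i + 1)), fun i => ?_⟩
  obtain ⟨h1, h2, -⟩ := hY i _ (hq (i + 1)).1
  refine ⟨?_, h1, (hq i).2, h2, fun s hs => ?_⟩
  · have := (hq i).1
    rw [mem_closedBall, dist_eq_norm] at this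
    exact this.trans (hεi i)
  · linarith [hYθ i _ (hq (i + 1)).1 s hs, hεi i, hεi0 i]

/-- One step of the construction of the limit of a sequence of trajectories. -/
lemma exists_tendsto_step {v : ℕ → ℝ → F} (hv : ∀ k, IsInput R (v k)) {θ : ℕ → ℝ → E}
    (hθ : ∀ k, IsTraj f (v k) (θ k)) {τ : ℕ → ℝ} {𝒰 : Ultrafilter ℕ}
    (hbig : ∀ c : ℝ, ∀ᶠ k in 𝒰, c < τ k + ‖θ k (τ k)‖) (hs : IsStep f R B h) {t : ℝ} (ht : 0 ≤ t)
    {p : E} (hp : ‖p‖ + 4 ≤ B) (hlim : Tendsto (fun k => θ k t) 𝒰 (𝓝 p))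
    (hτ : ∀ᶠ k in 𝒰, t ≤ τ k) :
    ∃ p', Tendsto (fun k => θ k (t + h)) 𝒰 (𝓝 p') ∧ ∀ᶠ k in 𝒰, t + h ≤ τ k := by
  have hmove : ∀ᶠ k in 𝒰, ∀ s ∈ Icc t (t + h), ‖θ k s‖ ≤ ‖p‖ + 2 := by
    filter_upwards [hlim (closedBall_mem_nhds p one_pos)] with k hk s hsm
    rw [mem_preimage, mem_closedBall, dist_eq_norm] at hk
    have h1 := norm_sub_norm_le (θ k t) p
    have h2 := ((hθ k).isSolOn (b := t + h) ht).norm_sub_left_le (hv k) hs (by simp)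
      (by linarith) hsm
    have h3 := norm_sub_norm_le (θ k s) (θ k t)
    linarith
  have hth : t + h ∈ Icc t (t + h) := right_mem_Icc.2 (by linarith [hs.pos])
  obtain ⟨p', -, hp'⟩ := (isCompact_closedBall (0 : E) (‖p‖ + 2)).ultrafilter_le_nhds
    (𝒰.map fun k => θ k (t + h)) (tendsto_principal.2 (hmove.mono fun k hk => by
      simpa using hk _ hth))
  refine ⟨p', hp', ?_⟩
  -- If `τ k` fell in `[t, t + h]`, both `τ k` and the norm there would be bounded, contradicting
  -- `hbig`.
  filter_upwards [hmove, hτ, hbig (t + h + ‖p‖ + 2)] with k h1 h2 h3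
  by_contra! hc
  linarith [h1 (τ k) ⟨h2, hc.le⟩]

/-- If every trajectory comes within `r' < r` of the origin, then trajectories that stay away from
the ball of radius `r` are uniformly bounded, and exist only for a bounded time. -/
theorem exists_uniform_bound_outside (hf : IsRegularField f) {r r' : ℝ} (hr : r' < r)
    (hex : ∀ v, IsInput R v → ∀ x, ∃ y, IsTraj f v y ∧ y 0 = x)
    (hreach : ∀ v, IsInput R v → ∀ y, IsTraj f v y → ∃ t, 0 ≤ t ∧ ‖y t‖ ≤ r') (R₁ : ℝ) :
    ∃ N : ℝ, ∀ v, IsInput R v → ∀ y, IsTraj f v y → ‖y 0‖ ≤ R₁ → ∀ t, 0 ≤ t →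
      (∀ s ∈ Icc 0 t, r ≤ ‖y s‖) → t + ‖y t‖ ≤ N := by
  by_contra! hcon
  choose v hv θ hθ hθ0 τ hτ0 hτr hτ using fun k : ℕ => hcon k
  let 𝒰 : Ultrafilter ℕ := hyperfilter ℕ
  have hbig : ∀ c : ℝ, ∀ᶠ k in 𝒰, c < τ k + ‖θ k (τ k)‖ := fun c => by
    obtain ⟨N, hN⟩ := exists_nat_ge c
    have : ∀ᶠ k in 𝒰, N ≤ k := Nat.hyperfilter_le_atTop (eventually_ge_atTop N)
    filter_upwards [this] with k hk
    exact (hN.trans (by exact_mod_cast hk)).trans_lt (hτ k)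
  choose st hst using fun j : ℕ => hf.exists_isStep R (j + 4)
  -- The step depends only on the integer `⌈‖p‖⌉₊`, so it takes finitely many values, hence has a
  -- positive minimum, on bounded sets.
  let H : E → ℝ := fun p => st ⌈‖p‖⌉₊
  have hH : ∀ p : E, IsStep f R ((⌈‖p‖⌉₊ : ℝ) + 4) (H p) := fun p => hst _
  have hHp : ∀ p : E, ‖p‖ + 4 ≤ (⌈‖p‖⌉₊ : ℝ) + 4 := fun p => by linarith [Nat.le_ceil ‖p‖]
  let Good : ℝ × E → Prop := fun s => 0 ≤ s.1 ∧ Tendsto (fun k => θ k s.1) 𝒰 (𝓝 s.2) ∧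
    ∀ᶠ k in 𝒰, s.1 ≤ τ k
  obtain ⟨p₀, -, hp₀⟩ := (isCompact_closedBall (0 : E) R₁).ultrafilter_le_nhds
    (𝒰.map fun k => θ k 0) (tendsto_principal.2 (Eventually.of_forall fun k => by
      simpa using hθ0 k))
  have good₀ : Good (0, p₀) := ⟨le_rfl, hp₀, Eventually.of_forall hτ0⟩
  have hstep : ∀ s : {s // Good s}, ∃ p', Good (s.1.1 + H s.1.2, p') := fun s => by
    obtain ⟨p', h1, h2⟩ := exists_tendsto_step hv hθ hbig (hH s.1.2) s.2.1 (hHp _) s.2.2.1 s.2.2.2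
    exact ⟨p', add_nonneg s.2.1 (hH _).pos.le, h1, h2⟩
  choose P hP using hstep
  let S : ℕ → {s // Good s} := Nat.rec ⟨_, good₀⟩ fun _ s => ⟨_, hP s⟩
  let t : ℕ → ℝ := fun i => (S i).1.1
  let p : ℕ → E := fun i => (S i).1.2
  have ht : ∀ i, t (i + 1) = t i + H (p i) := fun i => rfl
  have htn : ∀ i, 0 ≤ t i := fun i => (S i).2.1
  have hmono : StrictMono t := strictMono_nat_of_lt_succ fun i => by
    rw [ht]; linarith [(hH (p i)).pos]
  obtain ⟨ε, hε, hε1, hεr⟩ : ∃ ε : ℝ, 0 < ε ∧ ε ≤ 1 ∧ r' < r - ε :=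
    ⟨min 1 ((r - r') / 2), lt_min one_pos (by linarith), min_le_left _ _, by
      have := min_le_right 1 ((r - r') / 2); linarith⟩
  -- The index `k` may change with `i`: only the end points of the pieces have to match
  -- approximately.
  have hk : ∀ i, ∃ k, ‖θ k (t i) - p i‖ ≤ ε / 8 ^ i / 2 ∧
      ‖θ k (t (i + 1)) - p (i + 1)‖ ≤ ε / 8 ^ (i + 1) ∧ t (i + 1) ≤ τ k := fun i => by
    have h1 : ∀ᶠ k in 𝒰, θ k (t i) ∈ closedBall (p i) (ε / 8 ^ i / 2) :=
      (S i).2.2.1 (closedBall_mem_nhds _ (show 0 < ε / 8 ^ i / 2 by positivity))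
    have h2 : ∀ᶠ k in 𝒰, θ k (t (i + 1)) ∈ closedBall (p (i + 1)) (ε / 8 ^ (i + 1)) :=
      (S (i + 1)).2.2.1
      (closedBall_mem_nhds _ (show 0 < ε / 8 ^ (i + 1) by positivity))
    obtain ⟨k, h1, h2, h3⟩ := (h1.and (h2.and (S (i + 1)).2.2.2)).exists
    rw [mem_closedBall, dist_eq_norm] at h1 h2
    exact ⟨k, h1, h2, h3⟩
  choose κ hκl hκr hκτ using hk
  have hsol : ∀ i, IsSolOn f (v (κ i)) (t i) (t (i + 1)) (θ (κ i)) := fun i =>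
    (hθ (κ i)).isSolOn (htn i)
  obtain ⟨q, Y, hqY⟩ := exists_shadowing hf (fun i => hv (κ i)) hε hε1 ht (fun i => hH (p i))
    (fun i => hHp (p i)) hsol hκl hκr
  obtain ⟨w, hw, hwv⟩ := exists_concat_input (fun i => hv (κ i)) hmono
  obtain ⟨y, hy, hy0⟩ := hex w hw (q 0)
  have hEq : ∀ i, y (t i) = q i → EqOn y (Y i) (Icc (t i) (t (i + 1))) := fun i hi =>
    ((hy.isSolOn (htn i)).congr_input (hwv i)).eqOn hf (hv _) (hqY i).2.1
      (hi.trans (hqY i).2.2.1.symm)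
  have hyq : ∀ i, y (t i) = q i := by
    intro i
    induction i with
    | zero => exact hy0
    | succ i ih =>
      rw [hEq i ih (right_mem_Icc.2 (hmono (Nat.lt_succ_self i)).le)]
      exact (hqY i).2.2.2.1
  -- This is where global existence enters: were the grid times bounded, `y` would be bounded on a
  -- compact interval containing them, hence so would the `p i`, and the steps would be bounded
  -- below.
  have htop : Tendsto t atTop atTop := by
    refine hmono.monotone.tendsto_atTop_atTop fun T => ?_
    by_contra! hT
    obtain ⟨C, hC⟩ := isCompact_Icc.exists_bound_of_continuousOn
      (hy.continuous.continuousOn (s := Icc 0 T))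
    have hpC : ∀ i, ‖p i‖ ≤ C + 1 := fun i => by
      have h1 := hC (t i) ⟨htn i, (hT i).le⟩
      rw [hyq i] at h1
      have h2 := (hqY i).1
      rw [norm_sub_rev] at h2
      have h3 := norm_sub_norm_le (p i) (q i)
      linarith
    obtain ⟨j₀, -, hj₀⟩ := Finset.exists_min_image (Finset.range (⌈C + 1⌉₊ + 1)) st ⟨0, by simp⟩
    have hHp : ∀ i, st j₀ ≤ H (p i) := fun i => by
      refine hj₀ _ ?_
      have := Nat.ceil_mono (hpC i)
      simp only [Finset.mem_range]
      omega
    have hti : ∀ i : ℕ, i * st j₀ ≤ t i := fun i => by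
      induction i with
      | zero => simpa using htn 0
      | succ i ih => rw [ht]; push_cast; linarith [hHp i]
    obtain ⟨i, hi⟩ := exists_nat_ge (T / st j₀)
    rw [div_le_iff₀ (hst j₀).pos] at hi
    linarith [hti i, hT i]
  obtain ⟨s, hs0, hs⟩ := hreach w hw y hy
  have hfind : ∃ i, s < t (i + 1) :=
    ((tendsto_add_atTop_iff_nat 1).2 htop |>.eventually_gt_atTop s).exists
  classical
  have hi2 := Nat.find_spec hfind
  have hi1 : t (Nat.find hfind) ≤ s := by
    rcases Nat.eq_zero_or_pos (Nat.find hfind) with h0 | h0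
    · rw [h0]; exact hs0
    · have := Nat.find_min hfind (m := Nat.find hfind - 1) (by omega)
      rw [Nat.sub_add_cancel h0] at this
      exact not_lt.1 this
  have hmem : s ∈ Icc (t (Nat.find hfind)) (t (Nat.find hfind + 1)) := ⟨hi1, hi2.le⟩
  -- At time `s` the solution `y` has norm at most `r'`, yet it is `ε`-close to a piece of norm at
  -- least `r`, and `r' < r - ε`.
  have h1 := (hqY _).2.2.2.2 s hmem
  rw [← hEq _ (hyq _) hmem, norm_sub_rev] at h1
  have h2 := hτr (κ (Nat.find hfind)) s ⟨hs0, hi2.le.trans (hκτ _)⟩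
  have h3 := norm_sub_norm_le (θ (κ (Nat.find hfind)) s) (y s)
  linarith

end UniformReaching

/-! ### From Carathéodory solutions and `L^∞` inputs to integral equations -/

namespace ControlSystem

variable {n m : ℕ}
  {f : EuclideanSpace ℝ (Fin n) → EuclideanSpace ℝ (Fin m) → EuclideanSpace ℝ (Fin n)}
  {x : EuclideanSpace ℝ (Fin n)} {u : InputSpace m} {T : ℝ≥0∞} {R : ℝ}
  {v : ℝ → EuclideanSpace ℝ (Fin m)} {y : ℝ → EuclideanSpace ℝ (Fin n)}

/-- `v` is a representative of the input `u` at positive times. -/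
def Represents (u : InputSpace m) (v : ℝ → EuclideanSpace ℝ (Fin m)) : Prop :=
  ∀ᵐ t : ℝ, 0 < t → u t = v t

/-- Setting `u` to zero where it exceeds its essential supremum changes it only on a null set and
makes the bound hold everywhere. -/
lemma exists_represents (u : InputSpace m) : ∃ v, IsInput ‖u‖ v ∧ Represents u v := by
  have hm : Measurable (u : ℝ → EuclideanSpace ℝ (Fin m)) := (Lp.stronglyMeasurable u).measurable
  have hle : ∀ᵐ t ∂(volume.restrict (Ici (0 : ℝ))), ‖u t‖ ≤ ‖u‖ := by
    filter_upwards [ae_le_eLpNormEssSup (f := u) (μ := volume.restrict (Ici (0 : ℝ)))] with t ht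
    rw [Lp.norm_def, eLpNorm_exponent_top, ← toReal_enorm]
    refine ENNReal.toReal_mono ?_ ht
    rw [← eLpNorm_exponent_top]
    exact (Lp.memLp u).2.ne
  refine ⟨{t | ‖u t‖ ≤ ‖u‖}.indicator u,
    ⟨hm.indicator (measurableSet_le hm.norm measurable_const), fun t => ?_⟩, ?_⟩
  · by_cases ht : t ∈ {t | ‖u t‖ ≤ ‖u‖}
    · rw [indicator_of_mem ht]; exact ht
    · rw [indicator_of_notMem ht, norm_zero]; exact norm_nonneg u
  · rw [ae_restrict_iff' measurableSet_Ici] at hle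
    filter_upwards [hle] with t ht ht0
    rw [indicator_of_mem (show t ∈ {t | ‖u t‖ ≤ ‖u‖} from ht ht0.le)]

lemma exists_represented (hv : IsInput R v) : ∃ u : InputSpace m, ‖u‖ ≤ R ∧ Represents u v := by
  have hR : 0 ≤ R := (norm_nonneg _).trans (hv.norm_le 0)
  have hmem : MemLp v ∞ (volume.restrict (Ici (0 : ℝ))) :=
    memLp_top_of_bound hv.measurable.aestronglyMeasurable R (Eventually.of_forall hv.norm_le)
  refine ⟨hmem.toLp v, ?_, ?_⟩
  · rw [Lp.norm_toLp]
    refine ENNReal.toReal_le_of_le_ofReal hR ?_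
    rw [eLpNorm_exponent_top]
    exact eLpNormEssSup_le_of_ae_bound (Eventually.of_forall hv.norm_le)
  · have := hmem.coeFn_toLp
    rw [EventuallyEq, ae_restrict_iff' measurableSet_Ici] at this
    exact this.mono fun t ht ht0 => ht ht0.le

/-- Caratheodory solutions solve the integral equation. -/
lemma IsSolution.isSolOn (hf : IsRegularField f) (hv : IsInput R v) (huv : Represents u v)
    (hy : IsSolution f x u T y) {s : ℝ≥0} (hs : (s : ℝ≥0∞) < T) : IsSolOn f v 0 s y := by
  have h0s : (0 : ℝ) ≤ s := s.2
  have hac := hy.absolutelyContinuous s hs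
  have hyc : ContinuousOn y (Icc 0 s) := by simpa [uIcc_of_le h0s] using hac.continuousOn
  have hint : ∀ {a b : ℝ}, a ∈ Icc (0 : ℝ) s → b ∈ Icc (0 : ℝ) s →
      IntervalIntegrable (fun τ => f (y τ) (v τ)) volume a b := hf.intervalIntegrable hv hyc
  have h0 : (0 : ℝ) ∈ Icc (0 : ℝ) s := left_mem_Icc.2 h0s
  obtain ⟨C, hC⟩ := isCompact_Icc.exists_bound_of_continuousOn hyc
  obtain ⟨M, hM0, hM⟩ := hf.exists_norm_le R C
  have hlip : LipschitzOnWith M.toNNReal (fun t => ∫ τ in (0 : ℝ)..t, f (y τ) (v τ))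
      (uIcc 0 (s : ℝ)) := by
    rw [uIcc_of_le h0s]
    refine LipschitzOnWith.of_dist_le_mul fun a ha b hb => ?_
    rw [dist_eq_norm, intervalIntegral.integral_interval_sub_left (hint h0 ha) (hint h0 hb),
      Real.coe_toNNReal _ hM0.le, Real.dist_eq]
    refine intervalIntegral.norm_integral_le_of_norm_le_const fun τ hτ => ?_
    exact hM _ _ (hC τ (uIcc_subset_Icc hb ha (uIoc_subset_uIcc hτ))) (hv.norm_le τ)
  -- `y` minus the integral of its right-hand side is absolutely continuous with derivative zero
  -- almost everywhere, hence constant.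
  obtain ⟨c, hc⟩ := (hac.sub hlip.absolutelyContinuousOnInterval).const_of_ae_hasDerivAt_zero (by
    have hne : ∀ᵐ t : ℝ, t ≠ 0 := by simp [ae_iff]
    filter_upwards [hne, huv, hy.deriv,
      (hint h0 (right_mem_Icc.2 h0s)).ae_hasDerivAt_integral] with t h1 h2 h3 h4 ht
    have ht' := ht
    rw [uIcc_of_le h0s] at ht'
    have hpos : 0 < t := lt_of_le_of_ne ht'.1 h1.symm
    have hlt : ENNReal.ofReal t < T := lt_of_le_of_lt
      (by rw [← ENNReal.ofReal_coe_nnreal]; exact ENNReal.ofReal_le_ofReal ht'.2) hs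
    have := (h3 hpos hlt).sub (h4 ht 0 left_mem_uIcc)
    rwa [h2 hpos, sub_self] at this)
  rw [uIcc_of_le h0s] at hc
  refine ⟨hyc, fun a ha b hb => ?_⟩
  have h1 := hc a ha
  have h2 := hc b hb
  rw [← intervalIntegral.integral_interval_sub_left (hint h0 hb) (hint h0 ha)]
  simp only [Pi.sub_apply] at h1 h2
  rw [sub_eq_iff_eq_add] at h1 h2
  rw [h1, h2]
  abel

/-- In a forward complete system, there are global Caratheodory solutions. -/
lemma ForwardComplete.exists_isSolution (hf : IsRegularField f) (hfc : ForwardComplete f)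
    (x : EuclideanSpace ℝ (Fin n)) (u : InputSpace m) : ∃ y, IsSolution f x u ∞ y := by
  obtain ⟨v, hv, huv⟩ := exists_represents u
  have hex : ∀ N : ℕ, ∃ y T, ((N : ℝ≥0) : ℝ≥0∞) < T ∧ IsSolution f x u T y := fun N => by
    have : ((N : ℝ≥0) : ℝ≥0∞) < sSup {T | ∃ y, IsSolution f x u T y} := by
      rw [show sSup {T | ∃ y, IsSolution f x u T y} = ∞ from hfc x u]
      exact ENNReal.coe_lt_top
    obtain ⟨T, ⟨y, hy⟩, hT⟩ := lt_sSup_iff.1 this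
    exact ⟨y, T, hT, hy⟩
  choose Y T hT hY using hex
  have hsol : ∀ N : ℕ, IsSolOn f v 0 N (Y N) := fun N => by
    simpa using (hY N).isSolOn hf hv huv (hT N)
  have heq : ∀ {N M : ℕ}, N ≤ M → EqOn (Y N) (Y M) (Icc 0 (N : ℝ)) := fun {N M} hNM =>
    (hsol N).eqOn hf hv ((hsol M).mono (Icc_subset_Icc_right (by exact_mod_cast hNM)))
      ((hY N).initial.trans (hY M).initial.symm)
  -- An infinite supremum of existence times only supplies solutions on arbitrarily long intervals;
  -- by uniqueness they glue together.
  have hy : ∀ N : ℕ, EqOn (fun t => Y ⌈t⌉₊ t) (Y N) (Icc 0 (N : ℝ)) := fun N t ht =>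
    heq (Nat.ceil_le.2 ht.2) ⟨ht.1, Nat.le_ceil t⟩
  refine ⟨fun t => Y ⌈t⌉₊ t, ENNReal.zero_lt_top, ?_, fun s _ => ?_, ?_⟩
  · simp [(hY _).initial]
  · obtain ⟨N, hN⟩ := exists_nat_ge (s : ℝ)
    have hN' : s ≤ (N : ℝ≥0) := by exact_mod_cast hN
    have hac := (hY N).absolutelyContinuous s (lt_of_le_of_lt (by exact_mod_cast hN') (hT N))
    refine Tendsto.congr' ?_ hac
    filter_upwards [mem_inf_of_right (mem_principal_self _)] with e he
    refine Finset.sum_congr rfl fun i hi => ?_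
    have hsub : uIcc 0 (s : ℝ) ⊆ Icc 0 (N : ℝ) := by
      rw [uIcc_of_le (NNReal.coe_nonneg s)]; exact Icc_subset_Icc_right hN
    have := he.1 i hi
    rw [← hy N (hsub this.1), ← hy N (hsub this.2)]
  · filter_upwards [ae_all_iff.2 fun N => (hY N).deriv] with t ht ht0 _
    have htN : t < (⌈t⌉₊ + 1 : ℕ) := by push_cast; linarith [Nat.le_ceil t]
    have hder := ht (⌈t⌉₊ + 1) ht0 (lt_trans (by
      rw [← ENNReal.ofReal_coe_nnreal]
      exact (ENNReal.ofReal_lt_ofReal_iff (ht0.trans htN)).2 htN) (hT _))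
    -- The index is raised by one so that the agreement holds on a full neighbourhood even when `t`
    -- is an integer.
    have hev : (fun t => Y ⌈t⌉₊ t) =ᶠ[𝓝 t] Y (⌈t⌉₊ + 1) := by
      filter_upwards [Ioo_mem_nhds ht0 htN] with τ hτ
      exact hy _ ⟨hτ.1.le, hτ.2.le⟩
    have h1 := hev.eq_of_nhds
    beta_reduce at h1
    rw [h1]
    exact hder.congr_of_eventuallyEq hev

/-- In a forward complete system, the flow solves the integral equation. -/
lemma ForwardComplete.isTraj_flow (hf : IsRegularField f) (hfc : ForwardComplete f)
    (hv : IsInput R v) (huv : Represents u v) (x : EuclideanSpace ℝ (Fin n)) :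
    ∃ y, IsTraj f v y ∧ y 0 = x ∧ ∀ t : ℝ≥0, flow f x u t = y t := by
  have hex : ∃ y, IsSolution f x u (maxTime f x u) y := by
    rw [hfc x u]; exact hfc.exists_isSolution hf x u
  obtain ⟨y, hyd⟩ : ∃ y, y = hex.choose := ⟨_, rfl⟩
  have hy : IsSolution f x u ∞ y := by
    have : IsSolution f x u (maxTime f x u) y := hyd ▸ hex.choose_spec
    rwa [hfc x u] at this
  have hflow : ∀ t : ℝ≥0, flow f x u t = y t := fun t => by
    rw [flow, dif_pos hex, hyd]
  have hsol : ∀ s : ℝ≥0, IsSolOn f v 0 s y := fun s => hy.isSolOn hf hv huv ENNReal.coe_lt_top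
  have hcont : ContinuousOn y (Ici 0) := fun t ht => by
    have h1 := (hsol (t.toNNReal + 1)).continuousOn t ⟨ht, by simp [Real.coe_toNNReal t ht]⟩
    refine h1.mono_of_mem_nhdsWithin ?_
    have h2 : Iic ((t.toNNReal + 1 : ℝ≥0) : ℝ) ∈ 𝓝 t :=
      Iic_mem_nhds (by simp [Real.coe_toNNReal t ht])
    exact inter_mem self_mem_nhdsWithin (mem_nhdsWithin_of_mem_nhds h2)
  -- `y` is arbitrary at negative times, whereas `IsTraj` asks for continuity on all of `ℝ`.
  refine ⟨fun t => y (max t 0), ⟨?_, fun s t hs ht => ?_⟩, ?_, fun t => ?_⟩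
  · exact hcont.comp_continuous (continuous_id.max continuous_const) fun t => le_max_right t 0
  · rw [max_eq_left hs, max_eq_left ht]
    have h1 := (hsol (max s.toNNReal t.toNNReal)).sub_eq s
      ⟨hs, by simp [hs, ht]⟩ t ⟨ht, by simp [hs, ht]⟩
    rw [h1]
    refine intervalIntegral.integral_congr fun τ hτ => ?_
    have : 0 ≤ τ := (le_min hs ht).trans hτ.1
    simp [max_eq_left this]
  · simpa using hy.initial
  · simp [hflow]

lemma ForwardComplete.exists_isTraj (hf : IsRegularField f) (hfc : ForwardComplete f)
    (hv : IsInput R v) (x : EuclideanSpace ℝ (Fin n)) : ∃ y, IsTraj f v y ∧ y 0 = x := by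
  obtain ⟨u, -, huv⟩ := exists_represented hv
  obtain ⟨y, h1, h2, -⟩ := hfc.isTraj_flow hf hv huv x
  exact ⟨y, h1, h2⟩

lemma ForwardComplete.flow_eq (hf : IsRegularField f) (hfc : ForwardComplete f)
    (hv : IsInput R v) (huv : Represents u v) (hy : IsTraj f v y) (t : ℝ≥0) :
    flow f (y 0) u t = y t := by
  obtain ⟨z, hz, hz0, hzt⟩ := hfc.isTraj_flow hf hv huv (y 0)
  rw [hzt]
  exact (hz.isSolOn le_rfl).eqOn hf hv (hy.isSolOn le_rfl) hz0 ⟨t.2, le_rfl⟩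

end ControlSystem

/-! ### Domination by comparison functions -/

section ComparisonFunctions

lemma IsClassK.pos {α : ℝ≥0 → ℝ≥0} (hα : IsClassK α) {r : ℝ≥0} (hr : 0 < r) : 0 < α r := by
  simpa [hα.map_zero] using hα.strictMono hr

lemma IsClassK.add {α γ : ℝ≥0 → ℝ≥0} (hα : IsClassK α) (hγ : IsClassK γ) :
    IsClassK fun r => α r + γ r :=
  ⟨hα.continuous.add hγ.continuous, hα.strictMono.add hγ.strictMono, by
    simp [hα.map_zero, hγ.map_zero]⟩

lemma IsClassK.add_id {α : ℝ≥0 → ℝ≥0} (hα : IsClassK α) : IsClassKInfty fun r => α r + r where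
  toIsClassK := hα.add ⟨continuous_id, strictMono_id, rfl⟩
  unbounded := by
    rintro ⟨B, hB⟩
    have h1 : α (B + 1) + (B + 1) ≤ B := hB ⟨B + 1, rfl⟩
    have h2 : B < B + 1 := lt_add_one B
    exact absurd (h1.trans_lt h2) (not_lt.2 le_add_self)

lemma IsClassK.add_le {α : ℝ≥0 → ℝ≥0} (hα : IsClassK α) (r s : ℝ≥0) :
    α (r + s) ≤ α (2 * r) + α (2 * s) := by
  rcases le_total r s with h | h
  · exact (hα.strictMono.monotone (by rw [two_mul]; gcongr)).trans le_add_self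
  · exact (hα.strictMono.monotone (by rw [two_mul]; gcongr)).trans le_self_add

lemma IsClassK.exists_le {α : ℝ≥0 → ℝ≥0} (hα : IsClassK α) {ε : ℝ≥0} (hε : 0 < ε) :
    ∃ δ, 0 < δ ∧ α δ ≤ ε := by
  have h1 : Tendsto α (𝓝 0) (𝓝 0) := by simpa [hα.map_zero] using hα.continuous.tendsto 0
  have h2 : ∀ᶠ r in 𝓝[>] (0 : ℝ≥0), α r < ε :=
    (h1.mono_left nhdsWithin_le_nhds).eventually_lt_const hε
  obtain ⟨δ, hδ, hpos⟩ := (h2.and self_mem_nhdsWithin).exists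
  exact ⟨δ, hpos, hδ.le⟩

/-- A nondecreasing function that is small near `0` is dominated by a `𝒦_∞` function. -/
lemma exists_isClassKInfty_ge {C : ℝ≥0 → ℝ≥0} (hC : Monotone C)
    (h0 : ∀ ε, 0 < ε → ∃ δ, 0 < δ ∧ C δ ≤ ε) : ∃ α, IsClassKInfty α ∧ ∀ r, C r ≤ α r := by
  let c : ℝ → ℝ := fun x => C x.toNNReal
  have hc : Monotone c := fun x y hxy => by
    exact_mod_cast hC (Real.toNNReal_le_toNNReal hxy)
  have hc0 : ∀ x, 0 ≤ c x := fun x => NNReal.coe_nonneg _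
  have hint : ∀ r : ℝ≥0, IntervalIntegrable (fun l => c (r * l)) volume 1 2 := fun r =>
    (hc.comp (monotone_mul_left_of_nonneg r.2)).intervalIntegrable
  -- Averaging `C` over `[r, 2r]` makes it continuous, and monotonicity keeps it between `C r` and
  -- `C (2 * r)`. Adding `r` at the end gives strictness and unboundedness.
  let g : ℝ≥0 → ℝ := fun r => ∫ l in (1 : ℝ)..2, c (r * l)
  have hg0 : ∀ r, 0 ≤ g r := fun r =>
    intervalIntegral.integral_nonneg (by norm_num) fun l _ => hc0 _
  have hgmono : Monotone g := fun r s hrs => by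
    refine intervalIntegral.integral_mono_on (by norm_num) (hint r) (hint s) fun l hl => hc ?_
    have : (r : ℝ) ≤ s := by exact_mod_cast hrs
    have hl0 : 0 ≤ l := by linarith [hl.1]
    gcongr
  have hgle : ∀ r : ℝ≥0, g r ≤ C (2 * r) := fun r => by
    have : g r ≤ ∫ _ in (1 : ℝ)..2, ((C (2 * r) : ℝ≥0) : ℝ) := by
      refine intervalIntegral.integral_mono_on (by norm_num) (hint r) (by simp) fun l hl => ?_
      have : c (r * l) ≤ c (2 * r) := hc (by
        rw [mul_comm]; exact mul_le_mul_of_nonneg_right hl.2 r.2)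
      refine this.trans_eq ?_
      change ((C (2 * (r : ℝ)).toNNReal : ℝ≥0) : ℝ) = _
      rw [show (2 * (r : ℝ)) = ((2 * r : ℝ≥0) : ℝ) by push_cast; ring, Real.toNNReal_coe]
    refine this.trans_eq ?_
    rw [intervalIntegral.integral_const]
    norm_num
  have hleg : ∀ r : ℝ≥0, (C r : ℝ) ≤ g r := fun r => by
    have : ∫ _ in (1 : ℝ)..2, ((C r : ℝ≥0) : ℝ) ≤ g r := by
      refine intervalIntegral.integral_mono_on (by norm_num) (by simp) (hint r) fun l hl => ?_
      have : c r ≤ c (r * l) := hc (le_mul_of_one_le_right r.2 hl.1)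
      simpa [c] using this
    refine le_trans (le_of_eq ?_) this
    rw [intervalIntegral.integral_const]
    norm_num
  have hg00 : g 0 = 0 := by
    refine le_antisymm (le_of_forall_pos_le_add fun ε hε => ?_) (hg0 0)
    obtain ⟨δ, hδ, hCδ⟩ := h0 ε.toNNReal (by simpa using hε)
    have h1 : C (2 * 0) ≤ ε.toNNReal := (hC (by simp)).trans hCδ
    have h2 : (C (2 * 0) : ℝ) ≤ ε := by
      rw [← Real.coe_toNNReal ε hε.le]; exact_mod_cast h1
    linarith [hgle 0]
  have hgcont : Continuous g := by
    rw [continuous_iff_continuousAt]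
    intro r
    rcases eq_zero_or_pos r with rfl | hr
    · rw [ContinuousAt, hg00, Metric.tendsto_nhds]
      intro ε hε
      obtain ⟨δ, hδ, hCδ⟩ := h0 (ε / 2).toNNReal (by simpa using hε)
      filter_upwards [Iio_mem_nhds (show (0 : ℝ≥0) < δ / 2 by positivity)] with s hs
      have h1 : C (2 * s) ≤ (ε / 2).toNNReal := (hC (by
        rw [mem_Iio, lt_div_iff₀ two_pos] at hs
        rw [mul_comm]; exact hs.le)).trans hCδ
      have h2 : (C (2 * s) : ℝ) ≤ ε / 2 := by
        rw [← Real.coe_toNNReal (ε / 2) (by linarith)]; exact_mod_cast h1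
      rw [Real.dist_0_eq_abs, abs_of_nonneg (hg0 s)]
      linarith [hgle s]
    · have hci : ∀ a b, IntervalIntegrable c volume a b := fun a b => hc.intervalIntegrable
      have hprim := intervalIntegral.continuous_primitive hci 0
      have heq : (fun s : ℝ≥0 => (s : ℝ)⁻¹ *
          ((∫ x in (0 : ℝ)..(s * 2), c x) - ∫ x in (0 : ℝ)..(s * 1), c x)) =ᶠ[𝓝 r] g := by
        filter_upwards [lt_mem_nhds hr] with s hs
        have hs' : (s : ℝ) ≠ 0 := by exact_mod_cast hs.ne'
        rw [intervalIntegral.integral_interval_sub_left (hci _ _) (hci _ _)]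
        simp only [g]
        rw [intervalIntegral.integral_comp_mul_left c hs', smul_eq_mul]
      refine ContinuousAt.congr ?_ heq
      have hr' : (r : ℝ) ≠ 0 := by exact_mod_cast hr.ne'
      refine (NNReal.continuous_coe.continuousAt.inv₀ hr').mul (Continuous.continuousAt ?_)
      exact (hprim.comp (NNReal.continuous_coe.mul continuous_const)).sub
        (hprim.comp (NNReal.continuous_coe.mul continuous_const))
  refine ⟨fun r => (g r).toNNReal + r, ⟨⟨?_, ?_, ?_⟩, ?_⟩, fun r => ?_⟩
  · exact (continuous_real_toNNReal.comp hgcont).add continuous_id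
  · exact Monotone.add_strictMono (fun r s hrs => Real.toNNReal_mono (hgmono hrs)) strictMono_id
  · simp [hg00]
  · rintro ⟨B, hB⟩
    have h1 := hB ⟨B + 1, rfl⟩
    exact absurd (lt_of_le_of_lt h1 (lt_add_one B)) (not_lt.2 le_add_self)
  · exact le_trans (NNReal.le_toNNReal_of_coe_le (hleg r)) le_self_add

/-- A nonincreasing function tending to `0` is dominated by an `ℒ` function. -/
lemma exists_isClassL_ge {l : ℝ≥0 → ℝ≥0} (hl : Antitone l) (h0 : Tendsto l atTop (𝓝 0)) :
    ∃ k, IsClassL k ∧ ∀ t, l t ≤ k t := by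
  have key : ∀ t : ℝ≥0, (if (1 + t)⁻¹ = 0 then 0 else l ((1 + t)⁻¹⁻¹ - 1)) = l t := fun t => by
    have : 0 < 1 + t := by positivity
    rw [if_neg (inv_ne_zero this.ne'), inv_inv, add_tsub_cancel_left]
  -- The substitution `s = (1 + t)⁻¹` turns decay at infinity into smallness at `0`.
  obtain ⟨α, hα, hle⟩ := exists_isClassKInfty_ge (C := fun s => if s = 0 then 0 else l (s⁻¹ - 1))
    (fun s s' hs => by
      by_cases h : s = 0
      · simp [h]
      · have h' : 0 < s := pos_iff_ne_zero.2 h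
        simp only [h, (h'.trans_le hs).ne', if_false]
        exact hl (tsub_le_tsub_right (inv_anti₀ h' hs) 1))
    (fun ε hε => by
      obtain ⟨T, hT⟩ := (h0.eventually_lt_const hε).exists
      exact ⟨(1 + T)⁻¹, inv_pos.2 (by positivity), (key T).trans_le hT.le⟩)
  refine ⟨fun t => α (1 + t)⁻¹, ⟨?_, fun s t hst => hα.strictMono ?_, ?_⟩, fun t => ?_⟩
  · exact hα.continuous.comp ((continuous_const.add continuous_id).inv₀ fun t => by
      have : 0 < 1 + t := by positivity
      exact this.ne')
  · exact inv_strictAnti₀ (by positivity) (by simpa using hst)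
  · have h1 : Tendsto (fun t : ℝ≥0 => (1 + t)⁻¹) atTop (𝓝 0) :=
      NNReal.tendsto_coe.1 (by
        simpa [Function.comp_def] using tendsto_inv_atTop_zero.comp (tendsto_atTop_add_const_left _ (1 : ℝ)
          (NNReal.tendsto_coe_atTop.2 tendsto_id)))
    have h2 := (hα.continuous.tendsto 0).comp h1
    rwa [hα.map_zero] at h2
  · exact (key t).symm.trans_le (hle (1 + t)⁻¹)

/-- A nondecreasing function is dominated by a continuous nondecreasing function. -/
lemma exists_continuous_monotone_ge {κ : ℝ≥0 → ℝ≥0} (hκ : Monotone κ) :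
    ∃ k : ℝ≥0 → ℝ≥0, Continuous k ∧ Monotone k ∧ ∀ r, κ r ≤ k r := by
  -- `κ 0` may be positive; shifting by `1` makes the function vanish near `0`.
  obtain ⟨α, hα, hle⟩ := exists_isClassKInfty_ge (C := fun r => if r < 1 then 0 else κ (r - 1))
    (fun s s' hs => by
      by_cases h : s < 1
      · simp [h]
      · simp only [h, not_lt.2 ((not_lt.1 h).trans hs), if_false]
        exact hκ (tsub_le_tsub_right hs 1))
    (fun ε hε => ⟨1 / 2, by positivity, by
      rw [if_pos (NNReal.half_lt_self one_ne_zero)]; exact zero_le⟩)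
  refine ⟨fun r => α (r + 1), hα.continuous.comp (continuous_id.add continuous_const),
    fun r s hrs => hα.strictMono.monotone (by gcongr), fun r => ?_⟩
  simpa using hle (r + 1)

/-- Normalised by `ψ n 0 + 1` and weighted by `2⁻ⁿ`, the functions `ψ n` have a sum that still tends
to `0`, by dominated convergence, and each of them is a multiple of at most this sum. -/
lemma exists_common_rate {ψ : ℝ≥0 → ℝ≥0 → ℝ≥0} (hanti : ∀ r, Antitone (ψ r))
    (hlim : ∀ r, Tendsto (ψ r) atTop (𝓝 0)) :
    ∃ l : ℝ≥0 → ℝ≥0, Antitone l ∧ Tendsto l atTop (𝓝 0) ∧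
      ∀ (n : ℕ) t, ψ n t ≤ 2 ^ n * (ψ n 0 + 1) * l t := by
  let a : ℝ≥0 → ℕ → ℝ≥0 := fun t n => (1 / 2) ^ n * (ψ n t / (ψ n 0 + 1))
  have hgeo : Summable fun n : ℕ => (1 / 2 : ℝ≥0) ^ n :=
    NNReal.summable_geometric (NNReal.half_lt_self one_ne_zero)
  have hbd : ∀ t n, a t n ≤ (1 / 2) ^ n := fun t n =>
    mul_le_of_le_one_right' (div_le_one_of_le₀ ((hanti n zero_le).trans le_self_add)
      (zero_le))
  have hsum : ∀ t, Summable (a t) := fun t => NNReal.summable_of_le (hbd t) hgeo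
  refine ⟨fun t => ∑' n, a t n, fun s t hst => ?_, ?_, fun n t => ?_⟩
  · refine (hsum t).tsum_le_tsum (fun n => ?_) (hsum s)
    have := hanti n hst
    simp only [a]
    gcongr
  · rw [← NNReal.tendsto_coe]
    simp only [NNReal.coe_tsum, NNReal.coe_zero]
    rw [show (0 : ℝ) = ∑' _ : ℕ, (0 : ℝ) by simp]
    refine tendsto_tsum_of_dominated_convergence (bound := fun n => ((1 / 2 : ℝ≥0) ^ n : ℝ≥0))
      (NNReal.summable_coe.2 hgeo) (fun n => ?_) (Eventually.of_forall fun t n => ?_)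
    · rw [← NNReal.coe_zero, NNReal.tendsto_coe]
      have := ((hlim n).div_const (ψ n 0 + 1)).const_mul ((1 / 2 : ℝ≥0) ^ n)
      simpa [a] using this
    · rw [NNReal.norm_eq]
      exact_mod_cast hbd t n
  · have h1 : a t n ≤ ∑' n, a t n := (hsum t).le_tsum n fun _ _ => zero_le
    have h2 : ψ n t = 2 ^ n * (ψ n 0 + 1) * a t n := by
      have : ψ n 0 + 1 ≠ 0 := by positivity
      simp only [a, one_div, inv_pow]
      field_simp
    rw [h2]
    gcongr

/-- Functions that decay like a `𝒦ℒ` function are dominated by a `𝒦ℒ` function. -/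
lemma exists_isClassKL_ge {ψ : ℝ≥0 → ℝ≥0 → ℝ≥0} (hmono : ∀ t, Monotone fun r => ψ r t)
    (hanti : ∀ r, Antitone (ψ r)) (hlim : ∀ r, Tendsto (ψ r) atTop (𝓝 0))
    {α : ℝ≥0 → ℝ≥0} (hα : IsClassK α) (hle : ∀ r t, ψ r t ≤ α r) :
    ∃ β, IsClassKL β ∧ ∀ r t, ψ r t ≤ β r t := by
  obtain ⟨l, hl, hl0, hψl⟩ := exists_common_rate hanti hlim
  obtain ⟨k, hk, hlk⟩ := exists_isClassL_ge hl hl0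
  obtain ⟨κ, hκc, hκm, hκ⟩ := exists_continuous_monotone_ge
    (κ := fun r => 2 ^ ⌈r⌉₊ * (ψ ⌈r⌉₊ 0 + 1)) (fun r s hrs => by
      have h1 := Nat.ceil_mono hrs
      have h2 : ψ ⌈r⌉₊ 0 ≤ ψ ⌈s⌉₊ 0 := hmono 0 (by exact_mod_cast h1)
      beta_reduce
      gcongr
      exact one_le_two)
  have hkpos : ∀ t, 0 < k t := fun t => (zero_le).trans_lt (hk.strictAnti (lt_add_one t))
  have hκpos : ∀ r, 0 < κ r := fun r => lt_of_lt_of_le (by positivity) (hκ r)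
  have hακ : StrictMono fun r => α r * κ r := fun r s hrs =>
    mul_lt_mul (hα.strictMono hrs) (hκm hrs.le) (hκpos r) (zero_le)
  -- Geometric mean of two bounds: `α r` vanishes at `r = 0` but does not decay in `t`, while `κ r *
  -- k t` decays but need not vanish at `r = 0`.
  refine ⟨fun r t => NNReal.sqrt (α r * κ r) * NNReal.sqrt (k t), ⟨?_, fun t => ⟨?_, ?_, ?_⟩,
    fun r hr => ⟨?_, ?_, ?_⟩⟩, fun r t => ?_⟩
  · exact (NNReal.continuous_sqrt.comp
      ((hα.continuous.comp continuous_fst).mul (hκc.comp continuous_fst))).mul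
      (NNReal.continuous_sqrt.comp (hk.continuous.comp continuous_snd))
  · exact (NNReal.continuous_sqrt.comp (hα.continuous.mul hκc)).mul continuous_const
  · exact fun r s hrs => mul_lt_mul_of_pos_right (NNReal.sqrt.strictMono (hακ hrs))
      (NNReal.sqrt_pos.2 (hkpos t))
  · simp [hα.map_zero]
  · exact continuous_const.mul (NNReal.continuous_sqrt.comp hk.continuous)
  · exact fun s t hst => mul_lt_mul_of_pos_left (NNReal.sqrt.strictMono (hk.strictAnti hst))
      (NNReal.sqrt_pos.2 (mul_pos (hα.pos hr) (hκpos r)))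
  · have := ((NNReal.continuous_sqrt.tendsto 0).comp hk.tendsto_zero).const_mul
      (NNReal.sqrt (α r * κ r))
    simpa using this
  · beta_reduce
    rw [← NNReal.sqrt_mul, NNReal.le_sqrt_iff_sq_le, sq, mul_assoc]
    refine mul_le_mul' (hle r t) ?_
    calc ψ r t ≤ ψ ⌈r⌉₊ t := hmono t (Nat.le_ceil r)
      _ ≤ 2 ^ ⌈r⌉₊ * (ψ ⌈r⌉₊ 0 + 1) * l t := hψl _ _
      _ ≤ κ r * k t := mul_le_mul' (hκ r) (hlk t)

end ComparisonFunctions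

/-! ### Uniform boundedness, uniform attraction and the `𝒦ℒ` estimate -/

section Stability

variable {Beh : ℝ≥0 → (ℝ≥0 → ℝ≥0) → Prop}

/-- Behaviours that are bounded, and small for small data, admit a `𝒦_∞` bound. -/
lemma exists_isClassKInfty_bound
    (hbd : ∀ R, ∃ C, ∀ ρ ≤ R, ∀ g, Beh ρ g → g 0 ≤ R → ∀ t, g t ≤ C)
    (hsmall : ∀ ε, 0 < ε → ∃ δ, 0 < δ ∧ ∀ ρ ≤ δ, ∀ g, Beh ρ g → g 0 ≤ δ → ∀ t, g t ≤ ε) :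
    ∃ α, IsClassKInfty α ∧ ∀ ρ g, Beh ρ g → ∀ t, g t ≤ α (max ρ (g 0)) := by
  let S : ℝ≥0 → Set ℝ≥0 := fun R => {x | ∃ ρ ≤ R, ∃ g, Beh ρ g ∧ g 0 ≤ R ∧ ∃ t, x = g t}
  have hS : ∀ R, BddAbove (S R) := fun R => by
    obtain ⟨C, hC⟩ := hbd R
    refine ⟨C, ?_⟩
    rintro _ ⟨ρ, hρ, g, hg, hg0, t, rfl⟩
    exact hC ρ hρ g hg hg0 t
  obtain ⟨α, hα, hle⟩ := exists_isClassKInfty_ge (C := fun R => sSup (S R))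
    (fun R R' hR => csSup_le' (by
      rintro _ ⟨ρ, hρ, g, hg, hg0, t, rfl⟩
      exact le_csSup (hS R') ⟨ρ, hρ.trans hR, g, hg, hg0.trans hR, t, rfl⟩))
    (fun ε hε => by
      obtain ⟨δ, hδ, h⟩ := hsmall ε hε
      refine ⟨δ, hδ, csSup_le' ?_⟩
      rintro _ ⟨ρ, hρ, g, hg, hg0, t, rfl⟩
      exact h ρ hρ g hg hg0 t)
  refine ⟨α, hα, fun ρ g hg t => le_trans ?_ (hle _)⟩
  exact le_csSup (hS _) ⟨ρ, le_max_left _ _, g, hg, le_max_right _ _, t, rfl⟩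

/-- Uniform boundedness and uniform attraction yield a `𝒦ℒ` estimate. -/
lemma exists_isClassKL_bound {α Γ : ℝ≥0 → ℝ≥0} (hα : IsClassK α)
    (hbd : ∀ ρ g, Beh ρ g → ∀ t, g t ≤ α (max ρ (g 0))) (hΓ : ∀ ρ, α ρ ≤ Γ ρ)
    (hatt : ∀ R ε, 0 < ε → ∃ T, ∀ ρ ≤ R, ∀ g, Beh ρ g → g 0 ≤ R → ∀ t, T ≤ t → g t ≤ ε + Γ ρ) :
    ∃ β, IsClassKL β ∧ ∀ ρ g, Beh ρ g → ∀ t, g t ≤ β (g 0) t + Γ ρ := by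
  let S : ℝ≥0 → ℝ≥0 → Set ℝ≥0 := fun R s =>
    {x | ∃ ρ ≤ R, ∃ g, Beh ρ g ∧ g 0 ≤ R ∧ ∃ t, s ≤ t ∧ x = g t - Γ ρ}
  have hle : ∀ R s, ∀ x ∈ S R s, x ≤ α R := by
    rintro R s _ ⟨ρ, hρ, g, hg, hg0, t, -, rfl⟩
    exact tsub_le_self.trans ((hbd ρ g hg t).trans (hα.strictMono.monotone (max_le hρ hg0)))
  have hS : ∀ R s, BddAbove (S R s) := fun R s => ⟨α R, hle R s⟩
  obtain ⟨β, hβ, hψ⟩ := exists_isClassKL_ge (ψ := fun R s => sSup (S R s))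
    (fun s R R' hR => csSup_le' (by
      rintro _ ⟨ρ, hρ, g, hg, hg0, t, ht, rfl⟩
      exact le_csSup (hS R' s) ⟨ρ, hρ.trans hR, g, hg, hg0.trans hR, t, ht, rfl⟩))
    (fun R s s' hs => csSup_le' (by
      rintro _ ⟨ρ, hρ, g, hg, hg0, t, ht, rfl⟩
      exact le_csSup (hS R s) ⟨ρ, hρ, g, hg, hg0, t, hs.trans ht, rfl⟩))
    (fun R => by
      refine tendsto_order.2 ⟨fun a ha => absurd ha (not_lt.2 zero_le), fun ε hε => ?_⟩
      obtain ⟨ε', hε', hlt⟩ := exists_between hε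
      obtain ⟨T, hT⟩ := hatt R ε' hε'
      filter_upwards [eventually_ge_atTop T] with s hs
      refine (csSup_le' ?_).trans_lt hlt
      rintro _ ⟨ρ, hρ, g, hg, hg0, t, ht, rfl⟩
      exact tsub_le_iff_right.2 (hT ρ hρ g hg hg0 t (hs.trans ht)))
    hα (fun R s => csSup_le' (hle R s))
  refine ⟨β, hβ, fun ρ g hg t => ?_⟩
  -- `β` is evaluated at `g 0`, so it serves only when `g 0` dominates the input bound; otherwise `α
  -- ρ ≤ Γ ρ` suffices.
  rcases le_total ρ (g 0) with h | h
  · exact tsub_le_iff_right.1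
      ((le_csSup (hS _ _) ⟨ρ, h, g, hg, le_rfl, t, le_rfl, rfl⟩).trans (hψ _ _))
  · have := hbd ρ g hg t
    rw [max_eq_left h] at this
    exact (this.trans (hΓ ρ)).trans le_add_self

variable {E F : Type*} [NormedAddCommGroup E] [NormedSpace ℝ E] [ProperSpace E]
  [NormedAddCommGroup F] [ProperSpace F] [MeasurableSpace F] [BorelSpace F]
  {f : E → F → E} {γ : ℝ≥0 → ℝ≥0}

/-- All trajectories come arbitrarily close to the ball of radius `γ ρ`, where `ρ` is a bound of
the input. -/
def HasLimitGain (f : E → F → E) (γ : ℝ≥0 → ℝ≥0) : Prop :=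
  ∀ (ρ : ℝ≥0) v, IsInput (ρ : ℝ) v → ∀ y, IsTraj f v y → ∀ ε : ℝ, 0 < ε →
    ∃ t, 0 ≤ t ∧ ‖y t‖ ≤ γ ρ + ε

/-- A trajectory outside the ball of radius `r` is restarted at its last visit to that ball, or at
time `0` if there is none; from there `exists_uniform_bound_outside` bounds it. -/
lemma HasLimitGain.exists_bound (hf : IsRegularField f)
    (hex : ∀ R v, IsInput R v → ∀ x, ∃ y, IsTraj f v y ∧ y 0 = x) (hγ : HasLimitGain f γ)
    (R : ℝ≥0) : ∃ C : ℝ≥0, ∀ v, IsInput (R : ℝ) v → ∀ y, IsTraj f v y → ‖y 0‖ ≤ R →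
      ∀ t, 0 ≤ t → ‖y t‖ ≤ C := by
  let r : ℝ := γ R + 2
  obtain ⟨N, hN⟩ := exists_uniform_bound_outside hf (R := R) (r := r) (r' := γ R + 1)
    (by simp only [r]; linarith) (hex R) (fun v hv y hy => hγ R v hv y hy 1 one_pos) (max R r)
  refine ⟨(max N r).toNNReal, fun v hv y hy hy0 t ht => le_trans ?_ (Real.le_coe_toNNReal _)⟩
  rcases ((Icc 0 t) ∩ (fun s => ‖y s‖) ⁻¹' Iic r).eq_empty_or_nonempty with hem | hne
  · have := hN v hv y hy (hy0.trans (le_max_left _ _)) t ht fun s hs => by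
      by_contra! hc
      exact notMem_empty s (hem ▸ ⟨hs, hc.le⟩)
    exact le_trans (by linarith) (le_max_left N r)
  · obtain ⟨s, ⟨hs, hsr⟩, hmax⟩ := (isCompact_Icc.inter_right
      (isClosed_Iic.preimage hy.continuous.norm)).exists_isGreatest hne
    rw [mem_preimage, mem_Iic] at hsr
    rcases hs.2.eq_or_lt with rfl | hst
    · exact hsr.trans (le_max_right _ _)
    have hout : ∀ τ ∈ Ioc s t, r ≤ ‖y τ‖ := fun τ hτ => by
      by_contra! hc
      exact absurd (hmax ⟨⟨hs.1.trans hτ.1.le, hτ.2⟩, hc.le⟩) (not_le.2 hτ.1)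
    have hout' : ∀ τ ∈ Icc s t, r ≤ ‖y τ‖ := fun τ hτ =>
      closure_minimal (s := Ioc s t) hout (isClosed_Ici.preimage hy.continuous.norm)
        (by rwa [closure_Ioc hst.ne])
    have := hN _ (hv.shift s) _ (hy.shift hs.1) (by simpa using hsr.trans (le_max_right _ _))
      (t - s) (sub_nonneg.2 hst.le) fun τ hτ => hout' _ ⟨by linarith [hτ.1], by linarith [hτ.2]⟩
    rw [add_sub_cancel] at this
    exact le_trans (by linarith) (le_max_left N r)

lemma HasLimitGain.exists_time (hf : IsRegularField f)
    (hex : ∀ R v, IsInput R v → ∀ x, ∃ y, IsTraj f v y ∧ y 0 = x) (hγ : HasLimitGain f γ)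
    (ρ R : ℝ≥0) {ε : ℝ} (hε : 0 < ε) : ∃ T : ℝ, ∀ v, IsInput (ρ : ℝ) v → ∀ y, IsTraj f v y →
      ‖y 0‖ ≤ R → ∃ s ∈ Icc 0 T, ‖y s‖ ≤ γ ρ + ε := by
  obtain ⟨N, hN⟩ := exists_uniform_bound_outside hf (R := ρ) (r := γ ρ + ε) (r' := γ ρ + ε / 2)
    (by linarith) (hex ρ) (fun v hv y hy => hγ ρ v hv y hy (ε / 2) (by linarith)) R
  refine ⟨max N 0 + 1, fun v hv y hy hy0 => ?_⟩
  by_contra! hc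
  have := hN v hv y hy hy0 (max N 0 + 1) (by positivity) fun s hs => (hc s hs).le
  linarith [le_max_left N 0, norm_nonneg (y (max N 0 + 1))]

/-- The reaching time is uniform with respect to the bound of the input. -/
lemma HasLimitGain.exists_uniform_time (hf : IsRegularField f)
    (hex : ∀ R v, IsInput R v → ∀ x, ∃ y, IsTraj f v y ∧ y 0 = x) (hγ : HasLimitGain f γ)
    (hγc : Continuous γ) (R : ℝ≥0) {ε : ℝ} (hε : 0 < ε) :
    ∃ T : ℝ, ∀ ρ ∈ Icc 0 R, ∀ v, IsInput (ρ : ℝ) v → ∀ y, IsTraj f v y →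
      ‖y 0‖ ≤ R → ∃ s ∈ Icc 0 T, ‖y s‖ ≤ γ ρ + ε := by
  refine isCompact_Icc.induction_on (p := fun S : Set ℝ≥0 => ∃ T : ℝ, ∀ ρ ∈ S, ∀ v,
    IsInput (ρ : ℝ) v → ∀ y, IsTraj f v y → ‖y 0‖ ≤ R → ∃ s ∈ Icc 0 T, ‖y s‖ ≤ γ ρ + ε)
    ⟨0, by simp⟩ (fun S S' hSS' ⟨T, hT⟩ => ⟨T, fun ρ hρ => hT ρ (hSS' hρ)⟩) ?_ fun ρ _ => ?_
  · rintro S S' ⟨T, hT⟩ ⟨T', hT'⟩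
    refine ⟨max T T', fun ρ hρ v hv y hy hy0 => ?_⟩
    rcases hρ with hρ | hρ
    · obtain ⟨s, hs, h⟩ := hT ρ hρ v hv y hy hy0
      exact ⟨s, ⟨hs.1, hs.2.trans (le_max_left _ _)⟩, h⟩
    · obtain ⟨s, hs, h⟩ := hT' ρ hρ v hv y hy hy0
      exact ⟨s, ⟨hs.1, hs.2.trans (le_max_right _ _)⟩, h⟩
  · have hcont : Tendsto (fun ρ => (γ ρ : ℝ)) (𝓝 ρ) (𝓝 (γ ρ)) :=
      (NNReal.continuous_coe.comp hγc).tendsto ρ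
    have hup : ∀ᶠ ρ' in 𝓝[>] ρ, (γ ρ' : ℝ) < γ ρ + ε / 3 :=
      (hcont.mono_left nhdsWithin_le_nhds).eventually_lt_const (by linarith)
    -- The time for a slightly larger bound `ρ'` serves all bounds near `ρ`; continuity of `γ` costs
    -- two thirds of `ε`.
    obtain ⟨ρ', hρ', hlt⟩ := (hup.and self_mem_nhdsWithin).exists
    obtain ⟨T, hT⟩ := hγ.exists_time hf hex ρ' R (show 0 < ε / 3 by linarith)
    refine ⟨{ρ'' | ρ'' < ρ' ∧ (γ ρ : ℝ) - ε / 3 < γ ρ''}, mem_nhdsWithin_of_mem_nhds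
      (inter_mem (Iio_mem_nhds hlt) (hcont.eventually_const_lt (by linarith))), T, ?_⟩
    rintro ρ'' ⟨h1, h2⟩ v hv y hy hy0
    obtain ⟨s, hs, h⟩ := hT v (hv.mono (by exact_mod_cast h1.le)) y hy hy0
    exact ⟨s, hs, by linarith⟩

/-- The norms of the trajectories for inputs bounded by `ρ`. -/
def NormTraj (f : E → F → E) (ρ : ℝ≥0) (g : ℝ≥0 → ℝ≥0) : Prop :=
  ∃ v y, IsInput (ρ : ℝ) v ∧ IsTraj f v y ∧ ∀ t : ℝ≥0, g t = ‖y t‖₊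

/-- The limit property and small trajectories for small data imply the ISS estimate. -/
theorem HasLimitGain.exists_isClassKL (hf : IsRegularField f)
    (hex : ∀ R v, IsInput R v → ∀ x, ∃ y, IsTraj f v y ∧ y 0 = x) (hγ : HasLimitGain f γ)
    (hγK : IsClassK γ) (hsmall : ∀ ε, 0 < ε → ∃ δ, 0 < δ ∧ ∀ ρ ≤ δ, ∀ g, NormTraj f ρ g →
      g 0 ≤ δ → ∀ t, g t ≤ ε) :
    ∃ β Γ, IsClassKL β ∧ IsClassK Γ ∧ ∀ ρ g, NormTraj f ρ g → ∀ t, g t ≤ β (g 0) t + Γ ρ := by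
  obtain ⟨α, hα, hbd⟩ := exists_isClassKInfty_bound (Beh := NormTraj f) (fun R => by
    obtain ⟨C, hC⟩ := hγ.exists_bound hf hex R
    refine ⟨C, fun ρ hρ g ⟨v, y, hv, hy, hg⟩ hg0 t => ?_⟩
    rw [hg] at hg0 ⊢
    exact hC v (hv.mono (by exact_mod_cast hρ)) y hy hg0 t t.2) hsmall
  have hmono := hα.strictMono.monotone
  have hK : IsClassK fun ρ => α (2 * γ ρ) :=
    ⟨hα.continuous.comp (continuous_const.mul hγK.continuous), fun r s hrs =>
      hα.strictMono (mul_lt_mul_of_pos_left (hγK.strictMono hrs) two_pos), by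
      simp [hγK.map_zero, hα.map_zero]⟩
  obtain ⟨β, hβ, h⟩ := exists_isClassKL_bound (Γ := fun ρ => α ρ + α (2 * γ ρ)) hα.toIsClassK hbd
    (fun ρ => le_self_add) (fun R ε hε => by
      obtain ⟨δ, hδ, hδε⟩ := hα.exists_le hε
      have hδ2 : (0 : ℝ) < (δ / 2 : ℝ≥0) := by exact_mod_cast half_pos hδ
      obtain ⟨T, hT⟩ := hγ.exists_uniform_time hf hex hγK.continuous R hδ2
      refine ⟨T.toNNReal, fun ρ hρ g ⟨v, y, hv, hy, hg⟩ hg0 t ht => ?_⟩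
      rw [hg] at hg0 ⊢
      obtain ⟨s, hs, hys⟩ := hT ρ ⟨zero_le, hρ⟩ v hv y hy hg0
      have hst : s ≤ t := hs.2.trans (Real.toNNReal_le_iff_le_coe.1 ht)
      -- Restarting at the reaching time `s` gives a bound for all later times.
      have h1 := hbd ρ (fun τ => ‖y (s + τ)‖₊) ⟨_, _, hv.shift s, hy.shift hs.1, fun _ => rfl⟩
        (t - s.toNNReal)
      have h2 : s + ((t - s.toNNReal : ℝ≥0) : ℝ) = t := by
        rw [NNReal.coe_sub (Real.toNNReal_le_iff_le_coe.2 hst), Real.coe_toNNReal s hs.1]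
        ring
      rw [h2] at h1
      have h3 : ‖y (s + (0 : ℝ≥0))‖₊ ≤ γ ρ + δ / 2 := by
        rw [NNReal.coe_zero, add_zero]; exact_mod_cast hys
      calc ‖y t‖₊ ≤ α (max ρ ‖y (s + (0 : ℝ≥0))‖₊) := h1
        _ ≤ α ρ + α (γ ρ + δ / 2) := by
          rcases le_total ρ ‖y (s + (0 : ℝ≥0))‖₊ with h | h
          · rw [max_eq_right h]; exact (hmono h3).trans le_add_self
          · rw [max_eq_left h]; exact le_self_add
        _ ≤ α ρ + (α (2 * γ ρ) + α (2 * (δ / 2))) := by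
          gcongr; exact hα.toIsClassK.add_le _ _
        _ ≤ α ρ + (α (2 * γ ρ) + ε) := by
          gcongr; rwa [mul_div_cancel₀ δ two_ne_zero]
        _ = ε + (α ρ + α (2 * γ ρ)) := by ring)
  exact ⟨β, _, hβ, hα.toIsClassK.add hK, h⟩

end Stability

/-! ### The two implications -/

namespace ControlSystem

variable {n m : ℕ}
  {f : EuclideanSpace ℝ (Fin n) → EuclideanSpace ℝ (Fin m) → EuclideanSpace ℝ (Fin n)}

lemma ISS.limitProperty (h : ISS f) : LimitProperty f := by
  obtain ⟨hfc, β, γ, hβ, hγ, hle⟩ := h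
  refine ⟨γ, hγ, fun x u => ?_⟩
  have hlim : Tendsto (β ‖x‖₊) atTop (𝓝 0) := by
    rcases eq_zero_or_pos ‖x‖₊ with h | h
    · have : β ‖x‖₊ = fun _ => 0 := funext fun t => by rw [h]; exact (hβ.classK t).map_zero
      rw [this]; exact tendsto_const_nhds
    · exact (hβ.classL _ h).tendsto_zero
  have hlim' : Tendsto (fun t => β ‖x‖₊ t + γ ‖u‖₊) atTop (𝓝 (γ ‖u‖₊)) := by
    simpa using hlim.add_const (γ ‖u‖₊)
  refine ge_of_tendsto' hlim' fun t => (ciInf_le (OrderBot.bddBelow _)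
    (⟨t, by rw [hfc x u]; exact ENNReal.coe_lt_top⟩ : {t : ℝ≥0 // (t : ℝ≥0∞) < maxTime f x u})).trans
    (hle x u t)

lemma ISS.uniformlyLocallyStable (h : ISS f) : UniformlyLocallyStable f := by
  obtain ⟨-, β, γ, hβ, hγ, hle⟩ := h
  refine ⟨_, _, 1, (hβ.classK 0).add_id, hγ.add_id, one_pos, fun x u t _ _ _ => ?_⟩
  have hanti : β ‖x‖₊ t ≤ β ‖x‖₊ 0 := by
    rcases eq_zero_or_pos ‖x‖₊ with h | h
    · rw [h, (hβ.classK t).map_zero]; exact zero_le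
    · exact (hβ.classL _ h).strictAnti.antitone zero_le
  exact (hle x u t).trans (add_le_add (hanti.trans le_self_add) le_self_add)

/-- The infimum need not be attained, hence the extra `ε` in `HasLimitGain`. -/
lemma LimitProperty.exists_hasLimitGain (hf : IsRegularField f) (hfc : ForwardComplete f)
    (h : LimitProperty f) : ∃ γ, IsClassK γ ∧ HasLimitGain f γ := by
  obtain ⟨γ, hγ, hle⟩ := h
  refine ⟨γ, hγ, fun ρ v hv y hy ε hε => ?_⟩
  obtain ⟨u, hu, huv⟩ := exists_represented hv
  have hne : Nonempty {t : ℝ≥0 // (t : ℝ≥0∞) < maxTime f (y 0) u} :=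
    ⟨⟨0, by rw [hfc]; exact ENNReal.coe_lt_top⟩⟩
  have hlt : γ ‖u‖₊ < γ ρ + ε.toNNReal :=
    (hγ.strictMono.monotone hu).trans_lt (lt_add_of_pos_right _ (by simpa using hε))
  obtain ⟨t, ht⟩ := exists_lt_of_ciInf_lt ((hle (y 0) u).trans_lt hlt)
  rw [hfc.flow_eq hf hv huv hy] at ht
  refine ⟨t, NNReal.coe_nonneg _, ?_⟩
  have h1 : (‖y (t : ℝ≥0)‖₊ : ℝ) ≤ (γ ρ + ε.toNNReal : ℝ≥0) := by exact_mod_cast ht.le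
  rwa [NNReal.coe_add, Real.coe_toNNReal _ hε.le] at h1

lemma UniformlyLocallyStable.small (hf : IsRegularField f) (hfc : ForwardComplete f)
    (h : UniformlyLocallyStable f) {ε : ℝ≥0} (hε : 0 < ε) :
    ∃ δ, 0 < δ ∧ ∀ ρ ≤ δ, ∀ g, NormTraj f ρ g → g 0 ≤ δ → ∀ t, g t ≤ ε := by
  obtain ⟨σ, γ, r, hσ, hγ, hr, hle⟩ := h
  obtain ⟨δ, hδ, hδε⟩ := (hσ.add hγ.toIsClassK).exists_le hε
  refine ⟨min δ r, lt_min hδ hr, fun ρ hρ g ⟨v, y, hv, hy, hg⟩ hg0 t => ?_⟩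
  obtain ⟨u, hu, huv⟩ := exists_represented hv
  have hu' : ‖u‖₊ ≤ min δ r := le_trans hu hρ
  have hy0 : ‖y 0‖₊ ≤ min δ r := by simpa [hg] using hg0
  have h1 := hle (y 0) u t (hy0.trans (min_le_right _ _)) (hu'.trans (min_le_right _ _))
    (by rw [hfc]; exact ENNReal.coe_lt_top)
  rw [hfc.flow_eq hf hv huv hy, ← hg] at h1
  refine h1.trans (le_trans ?_ hδε)
  exact add_le_add (hσ.strictMono.monotone (hy0.trans (min_le_left _ _)))
    (hγ.strictMono.monotone (hu'.trans (min_le_left _ _)))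

end ControlSystem

theorem mainTheorem1 (n m : ℕ)
    (f : EuclideanSpace ℝ (Fin n) → EuclideanSpace ℝ (Fin m) → EuclideanSpace ℝ (Fin n))
    (hcont : Continuous (Function.uncurry f))
    (hlip : ∀ C : ℝ, 0 < C → ∃ L : ℝ, 0 < L ∧
      ∀ (x y : EuclideanSpace ℝ (Fin n)) (v : EuclideanSpace ℝ (Fin m)),
        ‖x‖ ≤ C → ‖y‖ ≤ C → ‖v‖ ≤ C → ‖f y v - f x v‖ ≤ L * ‖y - x‖) :
    ControlSystem.ISS f ↔
      ControlSystem.ForwardComplete f ∧ ControlSystem.LimitProperty f ∧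
        ControlSystem.UniformlyLocallyStable f := by
  have hf : IsRegularField f := ⟨hcont, hlip⟩
  refine ⟨fun h => ⟨h.1, h.limitProperty, h.uniformlyLocallyStable⟩, ?_⟩
  rintro ⟨hfc, hlim, huls⟩
  obtain ⟨γ, hγK, hγ⟩ := hlim.exists_hasLimitGain hf hfc
  obtain ⟨β, Γ, hβ, hΓ, h⟩ := hγ.exists_isClassKL hf
    (fun R v hv x => hfc.exists_isTraj hf hv x) hγK fun ε hε => huls.small hf hfc hε
  refine ⟨hfc, β, Γ, hβ, hΓ, fun x u t => ?_⟩
  obtain ⟨v, hv, huv⟩ := ControlSystem.exists_represents u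
  obtain ⟨y, hy, rfl, hflow⟩ := hfc.isTraj_flow hf hv huv x
  rw [hflow]
  simpa using h ‖u‖₊ (fun t => ‖y t‖₊) ⟨v, y, hv, hy, fun _ => rfl⟩ t
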